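/- Fix the following notions. A binary-output $k$-state Quantum Generator consists of a unit vector $\psi_0\in\mathbb{C}^k$, a unitary $k\times k$ matrix $U$, and a partition of $\{1,\dots,k\}$ into two (possibly empty) classes labelled $0$ and $1$; for $\sigma\in\{0,1\}$ let $M_\sigma$ be the coordinate projection onto the class labelled $\sigma$. For each $n\ge 0$ its $n$-symbol output distribution $D_n$ on $\{0,1\}^n$ is $$D_n(x_1,\dots,x_n)=\|M_{x_n}U\cdots M_{x_1}U\psi_0\|_2^2 .$$ An evaluator circuit for a probability distribution $Q$ on $\{0,1\}^n$ is a Boolean circuit with $n$ inputs which on input $y\in\{0,1\}^n$ outputs the number $Q(y)\in[0,1]$ exactly, in fixed-point binary notation. Theorem. There are a polynomial $p$ in four variables and an algorithm (a computable function) with the following property. The algorithm takes as input $n$, $k$, rational numbers $\varepsilon>0$ and $0<\delta<1$, and a finite list of strings $x_1,\dots,x_m\in\{0,1\}^n$, and always outputs an evaluator circuit for some probability distribution $Q$ on $\{0,1\}^n$. Moreover, if $D_n$ is the $n$-symbol output distribution of any binary-output $k$-state Quantum Generator, if $$m\ \ge\ p\left(n,k,\tfrac1\varepsilon,\log\tfrac1\delta\right),$$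 and if $x_1,\dots,x_m$ are independent samples from $D_n$, then with probability at least $1-\delta$ $$\mathrm{KL}(D_n\,\|\,Q)<\varepsilon .$$ In other words, the class of output distributions of binary-output $k$-state Quantum Generators is learnable with an evaluator under the KL-divergence with sample complexity $\mathrm{poly}(n,k,\frac1\varepsilon,\log\frac1\delta)$. (No bound on the running time of the algorithm or on the size of the circuit is claimed.) -/

import Mathlib

open MeasureTheory

/-! ### Quantum generators -/

/-- A `k`-state quantum generator over a finite alphabet `S`: a unit vector of `ℂ^k`, a unitary
`k × k` matrix, and a projective measurement given by a partition of the `k` coordinates into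
classes indexed by `S` (the class of `σ` is `{i | outcome i = σ}`). -/
structure QuantumGenerator (k : ℕ) (S : Type) where
  initialState : EuclideanSpace ℂ (Fin k)
  norm_initialState : ‖initialState‖ = 1
  unitary : Matrix.unitaryGroup (Fin k) ℂ
  outcome : Fin k → S

namespace QuantumGenerator

variable {k : ℕ} {S : Type} [DecidableEq S]

/-- The projection `M_σ` onto the coordinates in the class of the measurement outcome `σ`. -/
def projection (G : QuantumGenerator k S) (σ : S) : Matrix (Fin k) (Fin k) ℂ :=
  Matrix.diagonal fun i => if G.outcome i = σ then 1 else 0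

/-- The unnormalized step `v ↦ M_σ U v`. -/
noncomputable def step (G : QuantumGenerator k S) (v : EuclideanSpace ℂ (Fin k)) (σ : S) :
    EuclideanSpace ℂ (Fin k) :=
  WithLp.toLp 2 ((G.projection σ * (G.unitary : Matrix (Fin k) (Fin k) ℂ)).mulVec v.ofLp)

/-- The probability `‖M_{x_n} U ⋯ M_{x_1} U ψ₀‖²` of the output `x_1, …, x_n`. -/
noncomputable def prob (G : QuantumGenerator k S) {n : ℕ} (x : Fin n → S) : ℝ :=
  ‖(List.ofFn x).foldl G.step G.initialState‖ ^ 2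

theorem sum_norm_step_sq [Fintype S] (G : QuantumGenerator k S)
    (v : EuclideanSpace ℂ (Fin k)) : ∑ σ, ‖G.step v σ‖ ^ 2 = ‖v‖ ^ 2 := by
  set U : Matrix (Fin k) (Fin k) ℂ := (G.unitary : Matrix (Fin k) (Fin k) ℂ) with hU
  have h1 : ∀ σ, ‖G.step v σ‖ ^ 2
      = ∑ i, if G.outcome i = σ then ‖U.mulVec v.ofLp i‖ ^ 2 else 0 := by
    intro σ
    rw [EuclideanSpace.norm_sq_eq]
    refine Finset.sum_congr rfl fun i _ => ?_
    simp only [step, projection, ← Matrix.mulVec_mulVec, Matrix.mulVec_diagonal, ← hU]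
    split_ifs <;> simp
  have h2 : ‖v‖ ^ 2 = ∑ i, ‖U.mulVec v.ofLp i‖ ^ 2 := by
    have h3 : ∀ w : Fin k → ℂ, ((∑ i, ‖w i‖ ^ 2 : ℝ) : ℂ) = star w ⬝ᵥ w := by
      intro w
      simp only [dotProduct, Pi.star_apply, RCLike.star_def]
      push_cast
      exact Finset.sum_congr rfl fun i _ => (RCLike.conj_mul (w i)).symm
    rw [EuclideanSpace.norm_sq_eq]
    have h4 : star U * U = 1 := Matrix.UnitaryGroup.star_mul_self G.unitary
    have h5 : ((∑ i, ‖v.ofLp i‖ ^ 2 : ℝ) : ℂ)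
        = ((∑ i, ‖U.mulVec v.ofLp i‖ ^ 2 : ℝ) : ℂ) := by
      rw [h3, h3, Matrix.star_mulVec, Matrix.dotProduct_mulVec, Matrix.vecMul_vecMul,
        ← Matrix.star_eq_conjTranspose, h4, Matrix.vecMul_one]
    exact_mod_cast h5
  simp_rw [h1, h2]
  rw [Finset.sum_comm]
  simp

theorem sum_norm_foldl_sq [Fintype S] (G : QuantumGenerator k S) (n : ℕ)
    (v : EuclideanSpace ℂ (Fin k)) :
    ∑ x : Fin n → S, ‖(List.ofFn x).foldl G.step v‖ ^ 2 = ‖v‖ ^ 2 := by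
  induction n generalizing v with
  | zero => simp
  | succ n ih =>
    rw [← (Fin.consEquiv fun _ => S).sum_comp, Fintype.sum_prod_type, ← G.sum_norm_step_sq v]
    refine Finset.sum_congr rfl fun σ _ => ?_
    rw [← ih]
    refine Finset.sum_congr rfl fun x _ => ?_
    simp [Fin.consEquiv, List.ofFn_succ]

/-- The `n`-symbol output distribution of a quantum generator. -/
noncomputable def outputDist [Fintype S] (G : QuantumGenerator k S) (n : ℕ) : PMF (Fin n → S) :=
  PMF.ofFintype (fun x => ENNReal.ofReal (G.prob x)) (by
    rw [← ENNReal.ofReal_sum_of_nonneg (fun x _ => by unfold prob; positivity)]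
    simp only [prob]
    rw [G.sum_norm_foldl_sq n, G.norm_initialState]
    simp)

end QuantumGenerator

/-! ### Evaluator circuits -/

/-- A Boolean circuit over the complete basis `{NAND}`, consisting of a list of gates and a list
of output wires. On `n` inputs, the wires `0, …, n - 1` carry the inputs and the wire `n + j`
carries the NAND of the two wires named by the `j`-th gate, which have to be earlier ones: a wire
that does not carry a value yet is read as the constant `0`. -/
abbrev EvaluatorCircuit : Type := List (ℕ × ℕ) × List ℕ

namespace EvaluatorCircuit

/-- The values of all wires, in order. -/
def wires (E : EvaluatorCircuit) (input : List Bool) : List Bool :=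
  E.1.foldl (fun w g => w ++ [!(w.getD g.1 false && w.getD g.2 false)]) input

/-- The values of the output wires, in order. -/
def outputs (E : EvaluatorCircuit) (input : List Bool) : List Bool :=
  E.2.map fun j => (E.wires input).getD j false

/-- The number that a list of bits denotes in fixed-point binary: `b₀.b₁b₂b₃…`, that is
`b₀ + b₁ / 2 + b₂ / 4 + ⋯`. -/
noncomputable def fixedPoint : List Bool → ℝ
  | [] => 0
  | b :: l => (if b then 1 else 0) + fixedPoint l / 2

/-- The number that the circuit computes on an input string. -/
noncomputable def value (E : EvaluatorCircuit) {n : ℕ} (y : Fin n → Bool) : ℝ :=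
  fixedPoint (E.outputs (List.ofFn y))

/-- The circuit computes the probabilities of the distribution `Q` on `{0,1}^n` (exactly). -/
def Computes (E : EvaluatorCircuit) {n : ℕ} (Q : PMF (Fin n → Bool)) : Prop :=
  ∀ y, (Q y).toReal = E.value y

end EvaluatorCircuit

/-! ### Distribution learning under the KL-divergence -/

/-- An ensemble `D = {D_n}_n` of distributions on the sets `{0,1}^n`. -/
abbrev BinaryEnsemble : Type := (n : ℕ) → PMF (Fin n → Bool)

/-- The input of a learning algorithm: `n`, `k`, `ε` and `δ` (two positive rationals, each given
as numerator and denominator), and the list of sampled strings. -/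
abbrev LearnerInput : Type := ℕ × ℕ × (ℕ × ℕ) × (ℕ × ℕ) × List (List Bool)

/-- The input made of `n`, `k`, `ε = e.1 / e.2`, `δ = d.1 / d.2` and the samples
`x_1, …, x_m ∈ {0,1}^n`. -/
def learnerInput (n k : ℕ) (e d : ℕ × ℕ) {m : ℕ} (x : Fin m → Fin n → Bool) : LearnerInput :=
  (n, k, e, d, List.ofFn fun i => List.ofFn (x i))

/-- The classes `C k` (`k` a size parameter that the algorithm is told) are learnable under the
KL-divergence with sample complexity `s n k ε δ`. There is an algorithm that, for all rational
`ε > 0` and `0 < δ < 1`, outputs an evaluator circuit for a distribution on `{0,1}^n`; and if it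
is given any number `m ≥ s n k ε δ` of independent samples from `D_n`, where `D` is an ensemble
from `C k`, then with probability at least `1 - δ` the distribution `Q` computed by the circuit
satisfies `KL(D_n ‖ Q) < ε`. -/
def LearnableKL (C : ℕ → Set BinaryEnsemble) (s : ℕ → ℕ → ℝ → ℝ → ℝ) : Prop :=
  ∃ A : LearnerInput → EvaluatorCircuit, Computable A ∧
    ∀ (n k : ℕ) (e d : ℕ × ℕ), 0 < e.1 → 0 < e.2 → 0 < d.1 → d.1 < d.2 →
      ∀ (ε δ : ℝ), ε = (e.1 : ℝ) / (e.2 : ℝ) → δ = (d.1 : ℝ) / (d.2 : ℝ) →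
        (∀ (m : ℕ) (x : Fin m → Fin n → Bool), ∃ Q : PMF (Fin n → Bool),
          (A (learnerInput n k e d x)).Computes Q) ∧
        ∀ D ∈ C k, ∀ m : ℕ, s n k ε δ ≤ (m : ℝ) →
          ENNReal.ofReal (1 - δ) ≤
            (Measure.pi fun _ : Fin m => (D n).toMeasure)
              {x | ∃ Q : PMF (Fin n → Bool), (A (learnerInput n k e d x)).Computes Q ∧
                InformationTheory.klDiv (D n).toMeasure Q.toMeasure < ENNReal.ofReal ε}

/-- The class of (ensembles of) output distributions of `k`-state quantum generators with two
output symbols. -/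
def quantumGeneratorClass (k : ℕ) : Set BinaryEnsemble :=
  {D | ∃ G : QuantumGenerator k Bool, D = G.outputDist}

/-! The learner maximizes the likelihood over a finite grid of explicit hypotheses, and the
logarithm of the grid size is polynomial. Separating real and imaginary parts, and then positive and
negative parts, turns a `k`-state generator into a weighted automaton with `4k` states and entries
in `[0,1]`. The probability of a word is a sum of squares of differences of its weights
(`exists_real_automaton`, `exists_nonneg_automaton`). Rounding the entries down to polynomially many
bits changes the probability of each word by at most `2^-(n+c+1)` (`exists_score_close`).

Scaling by `1 - 2^-c` and adding `2^-(n+c+1)` to each word absorbs this error. For the rounding of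
the target `p`, the total stays at most `1`, so the missing mass can go to one word, and the result
`q` satisfies `q ≥ (1 - 2^-c) p` (`exists_hypProb_ge`). Hence some hypothesis has divergence at most
`2 * 2^-c ≤ ε/2`. Every hypothesis also satisfies `q ≥ 2^-(n+c+1)`, so log-likelihood ratios are
bounded by `n+c+1`. Hoeffding's inequality and a union bound over the grid show that, with
probability at least `1 - δ`, no hypothesis of divergence at least `ε` is as likely as the good one
(`measure_divergence_lt_ge`).

For computability, all probabilities are dyadic with a common denominator, so being a maximizer
together with a correct circuit is a primitive recursive relation in natural numbers. Unbounded
search finds such a pair, because one exists: the grid is finite and NAND is complete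
(`exists_isOutput`). -/

namespace EvaluatorCircuit

/-! ### Completeness of NAND circuits -/

theorem wires_append (g g' : List (ℕ × ℕ)) (o o' : List ℕ) (w : List Bool) :
    wires (g ++ g', o) w = wires (g', o') (wires (g, o') w) := by
  simp [wires]

theorem length_wires (g : List (ℕ × ℕ)) (o : List ℕ) (w : List Bool) :
    (wires (g, o) w).length = w.length + g.length := by
  induction g generalizing w with
  | nil => simp [wires]
  | cons a g ih =>
    have := ih (w ++ [!(w.getD a.1 false && w.getD a.2 false)])
    simp only [wires, List.foldl_cons, List.length_append, List.length_cons,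
      List.length_nil] at this ⊢
    omega

theorem wires_getD_of_lt (g : List (ℕ × ℕ)) (o : List ℕ) (w : List Bool) {j : ℕ}
    (hj : j < w.length) : (wires (g, o) w).getD j false = w.getD j false := by
  induction g generalizing w with
  | nil => simp [wires]
  | cons a g ih =>
    have := ih (w ++ [!(w.getD a.1 false && w.getD a.2 false)]) (by simp; omega)
    simp only [wires, List.foldl_cons] at this ⊢
    rw [this, List.getD_append _ _ _ _ hj]

/-- Every list of gates has an extension with a wire that carries `f`. -/
def Realizable {n : ℕ} (f : (Fin n → Bool) → Bool) : Prop :=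
  ∀ g : List (ℕ × ℕ), ∃ g' : List (ℕ × ℕ), ∃ j, j < n + (g ++ g').length ∧
    ∀ y, (wires (g ++ g', []) (List.ofFn y)).getD j false = f y

variable {n : ℕ}

theorem wires_append_getD (g g' : List (ℕ × ℕ)) (y : Fin n → Bool) {j : ℕ}
    (hj : j < n + g.length) :
    (wires (g ++ g', []) (List.ofFn y)).getD j false
      = (wires (g, []) (List.ofFn y)).getD j false := by
  rw [wires_append _ _ _ [], wires_getD_of_lt]
  simpa [length_wires] using hj

theorem wires_concat_getD (g : List (ℕ × ℕ)) (a : ℕ × ℕ) (y : Fin n → Bool) :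
    (wires (g ++ [a], []) (List.ofFn y)).getD (n + g.length) false
      = !((wires (g, []) (List.ofFn y)).getD a.1 false
          && (wires (g, []) (List.ofFn y)).getD a.2 false) := by
  rw [wires_append _ _ _ []]
  conv_lhs => rw [wires]
  simp only [List.foldl_cons, List.foldl_nil]
  rw [List.getD_append_right _ _ _ _ (by simp [length_wires])]
  simp [length_wires]

/-- `Realizable` quantifies over an arbitrary initial list of gates so that circuits can be stacked:
the second function is built on top of the gates of the first, whose wire keeps its value. -/
theorem Realizable.nand {f f' : (Fin n → Bool) → Bool} (hf : Realizable f)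
    (hf' : Realizable f') : Realizable fun y => !(f y && f' y) := by
  intro g
  obtain ⟨g₁, j₁, hj₁, h₁⟩ := hf g
  obtain ⟨g₂, j₂, hj₂, h₂⟩ := hf' (g ++ g₁)
  refine ⟨g₁ ++ g₂ ++ [(j₁, j₂)], n + (g ++ g₁ ++ g₂).length, ?_, fun y => ?_⟩
  · simp
  · rw [← List.append_assoc, ← List.append_assoc, wires_concat_getD, h₂,
      wires_append_getD (g ++ g₁) g₂ y hj₁, h₁]

theorem realizable_proj (i : Fin n) : Realizable fun y : Fin n → Bool => y i := by
  intro g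
  refine ⟨[], i, by omega, fun y => ?_⟩
  rw [wires_getD_of_lt _ _ _ (by simp)]
  simp

theorem realizable_true : Realizable fun _ : Fin n → Bool => true := by
  intro g
  -- The gate names its own wire, which carries no value yet and is read as `false`; the NAND is
  -- `true`.
  refine ⟨[(n + g.length, n + g.length)], n + g.length, by simp, fun y => ?_⟩
  rw [wires_concat_getD, List.getD_eq_default _ _ (by simp [length_wires])]
  rfl

theorem Realizable.not {f : (Fin n → Bool) → Bool} (hf : Realizable f) :
    Realizable fun y => !f y := by
  simpa using hf.nand hf

theorem realizable_const (b : Bool) : Realizable fun _ : Fin n → Bool => b := by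
  cases b
  · simpa using (realizable_true (n := n)).not
  · exact realizable_true

/-- Shannon expansion, by induction on the set of relevant variables: `f` is the NAND of `y i NAND
f|_{y i = true}` and `¬ y i NAND f|_{y i = false}`. -/
theorem realizable_of_dependsOn (s : Finset (Fin n)) (f : (Fin n → Bool) → Bool)
    (hf : ∀ y y', (∀ i ∈ s, y i = y' i) → f y = f y') : Realizable f := by
  induction s using Finset.induction_on generalizing f with
  | empty =>
    have : f = fun _ => f fun _ => false := funext fun y => hf _ _ (by simp)
    rw [this]
    exact realizable_const _
  | insert i s _ ih =>
    have hr : ∀ b, Realizable fun y => f (Function.update y i b) := fun b =>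
      ih _ fun y y' hy => hf _ _ fun j hj => by
        rcases eq_or_ne j i with rfl | hne
        · simp
        · simpa [hne] using hy j ((Finset.mem_insert.1 hj).resolve_left hne)
    have hi := realizable_proj i
    convert (hi.nand (hr true)).nand (hi.not.nand (hr false)) using 1
    funext y
    cases hy : y i
    · have : Function.update y i false = y := by rw [← hy]; simp
      simp [this]
    · have : Function.update y i true = y := by rw [← hy]; simp
      simp [this]

theorem realizable (f : (Fin n → Bool) → Bool) : Realizable f :=
  realizable_of_dependsOn Finset.univ f fun _ _ h => congrArg f (funext fun i => h i (by simp))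

theorem exists_outputs_eq (F : List ((Fin n → Bool) → Bool)) :
    ∃ E : EvaluatorCircuit, ∀ y, E.outputs (List.ofFn y) = F.map fun f => f y := by
  suffices h : ∀ g : List (ℕ × ℕ), ∃ g' : List (ℕ × ℕ), ∃ o : List ℕ,
      (∀ j ∈ o, j < n + (g ++ g').length) ∧
      ∀ y, (o.map fun j => (wires (g ++ g', []) (List.ofFn y)).getD j false)
        = F.map fun f => f y by
    obtain ⟨g', o, -, ho⟩ := h []
    exact ⟨(g', o), ho⟩
  induction F with
  | nil => exact fun g => ⟨[], [], by simp, by simp⟩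
  | cons f F ih =>
    intro g
    obtain ⟨g₁, j, hj, h₁⟩ := realizable f g
    obtain ⟨g₂, o, ho, h₂⟩ := ih (g ++ g₁)
    refine ⟨g₁ ++ g₂, j :: o, ?_, fun y => ?_⟩
    · rw [← List.append_assoc]
      intro i hi
      rcases List.mem_cons.1 hi with rfl | hi
      · simp only [List.length_append] at hj ⊢; omega
      · exact ho i hi
    · rw [← List.append_assoc, List.map_cons, List.map_cons, h₂,
        wires_append_getD _ _ _ hj, h₁]

/-- The natural number that a list of bits denotes, the most significant bit first. -/
def bitsValue (l : List Bool) : ℕ := l.foldl (fun a b => 2 * a + cond b 1 0) 0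

/-- Horner's scheme with a general accumulator. The factor `2` appears because the leading bit has
weight `1` in `fixedPoint`. -/
theorem fixedPoint_mul_two_pow (l : List Bool) :
    fixedPoint l * 2 ^ l.length = 2 * (bitsValue l : ℝ) := by
  suffices h : ∀ a : ℕ, ((l.foldl (fun a b => 2 * a + cond b 1 0) a : ℕ) : ℝ) * 2
      = 2 * a * 2 ^ l.length + fixedPoint l * 2 ^ l.length by
    have := h 0
    rw [bitsValue]
    push_cast at this
    linarith
  induction l with
  | nil => intro a; simp [fixedPoint]; ring
  | cons b l ih =>
    intro a
    rw [List.foldl_cons, ih, fixedPoint, List.length_cons]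
    cases b <;> push_cast <;> simp <;> ring

theorem exists_bitsValue_eq (m t : ℕ) (ht : t < 2 ^ m) :
    ∃ l : List Bool, l.length = m ∧ bitsValue l = t := by
  induction m generalizing t with
  | zero => exact ⟨[], rfl, by simp [bitsValue]; omega⟩
  | succ m ih =>
    obtain ⟨l, hl, hv⟩ := ih (t / 2) (by rw [pow_succ] at ht; omega)
    refine ⟨l ++ [decide (t % 2 = 1)], by simp [hl], ?_⟩
    rw [bitsValue] at hv ⊢
    rw [List.foldl_append, hv]
    rcases Nat.mod_two_eq_zero_or_one t with h | h <;> simp [h] <;> omega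

theorem exists_bitsValue_outputs_eq (m : ℕ) (T : (Fin n → Bool) → ℕ) (hT : ∀ y, T y < 2 ^ m) :
    ∃ E : EvaluatorCircuit, E.2.length = m ∧
      ∀ y, bitsValue (E.outputs (List.ofFn y)) = T y := by
  choose l hl hv using fun y => exists_bitsValue_eq m (T y) (hT y)
  obtain ⟨E, hE⟩ := exists_outputs_eq ((List.range m).map fun i y => (l y).getD i false)
  have h : ∀ y, E.outputs (List.ofFn y) = l y := fun y => by
    rw [hE, List.map_map]
    refine List.ext_getElem (by simp [hl]) fun i h₁ h₂ => ?_
    simp [List.getElem?_eq_getElem h₂]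
  refine ⟨E, ?_, fun y => by rw [h, hv]⟩
  have := congrArg List.length (hE fun _ => false)
  simpa [outputs] using this

theorem value_eq (E : EvaluatorCircuit) {B : ℕ} (hE : E.2.length = B + 1) (y : Fin n → Bool) :
    E.value y = bitsValue (E.outputs (List.ofFn y)) / 2 ^ B := by
  have h := fixedPoint_mul_two_pow (E.outputs (List.ofFn y))
  have hl : (E.outputs (List.ofFn y)).length = B + 1 := by simp [outputs, hE]
  rw [hl, pow_succ] at h
  rw [value, eq_div_iff (by positivity)]
  linarith

end EvaluatorCircuit

/-! ### Primitive recursive functions -/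

namespace Primrec

variable {α β : Type} [Primcodable α] [Primcodable β]

theorem nat_pow' {f g : α → ℕ} (hf : Primrec f) (hg : Primrec g) :
    Primrec fun a => f a ^ g a := by
  have h : Primrec₂ fun a b : ℕ => a ^ b :=
    Primrec₂.unpaired'.1 Nat.Primrec.pow
  exact h.comp hf hg

theorem list_sum' {f : α → List ℕ} (hf : Primrec f) : Primrec fun a => (f a).sum := by
  have h : Primrec fun a => (f a).foldr (fun x y => x + y) 0 :=
    list_foldr hf (const 0) (nat_add.comp (fst.comp snd) (snd.comp snd)).to₂
  exact h.of_eq fun a => by rw [List.sum_eq_foldr]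

theorem list_prod' {f : α → List ℕ} (hf : Primrec f) : Primrec fun a => (f a).prod := by
  have h : Primrec fun a => (f a).foldr (fun x y => x * y) 1 :=
    list_foldr hf (const 1) (nat_mul.comp (fst.comp snd) (snd.comp snd)).to₂
  exact h.of_eq fun a => by rw [List.prod_eq_foldr]

theorem list_range_map {σ : Type} [Primcodable σ] {f : α → ℕ} {g : α → ℕ → σ} (hf : Primrec f)
    (hg : Primrec fun p : α × ℕ => g p.1 p.2) : Primrec fun a => (List.range (f a)).map (g a) :=
  list_map (list_range.comp hf) hg.to₂

theorem list_foldl_curried {σ : Type} [Primcodable σ] {f : α → List β} {g : α → σ}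
    {h : α → σ → β → σ} (hf : Primrec f) (hg : Primrec g)
    (hh : Primrec fun p : α × σ × β => h p.1 p.2.1 p.2.2) :
    Primrec fun a => (f a).foldl (h a) (g a) :=
  list_foldl (h := fun a q => h a q.1 q.2) hf hg hh.to₂

end Primrec

theorem PrimrecRel.forall_lt_comp {α : Type} [Primcodable α] {R : ℕ → α → Prop}
    {N : α → ℕ} (hR : PrimrecRel R) (hN : Primrec N) : PrimrecPred fun a => ∀ x < N a, R x a := by
  have h : PrimrecPred fun a => ∀ x ∈ List.range (N a), R x a :=
    hR.forall_mem_list.comp (Primrec.list_range.comp hN) Primrec.id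
  exact h.of_eq fun a => by simp

/-- Unbounded search for a solution of a primitive recursive relation is computable. -/
theorem PrimrecRel.exists_computable {α β : Type} [Primcodable α] [Primcodable β]
    {R : α → β → Prop} (hR : PrimrecRel R) (h : ∀ a, ∃ b, R a b) :
    ∃ f : α → β, Computable f ∧ ∀ a, R a (f a) := by
  classical
  -- Stage `m` of the search tests the element with code `m`, if there is one.
  let g : α → ℕ → Option β := fun a m =>
    (Encodable.decode m : Option β).bind fun b => if R a b then some b else none
  have hg : Computable₂ g := by
    refine Primrec.to_comp (Primrec.option_bind (Primrec.decode.comp Primrec.snd) ?_)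
    exact Primrec.ite (hR.comp (Primrec.fst.comp Primrec.fst) Primrec.snd)
      (Primrec.option_some.comp Primrec.snd) (Primrec.const none)
  have hd : ∀ a, (Nat.rfindOpt (g a)).Dom := fun a => by
    obtain ⟨b, hb⟩ := h a
    exact Nat.rfindOpt_dom.2 ⟨Encodable.encode b, b, by simp [g, hb]⟩
  refine ⟨fun a => (Nat.rfindOpt (g a)).get (hd a),
    (Partrec.rfindOpt hg).of_eq_tot fun a => Part.get_mem _, fun a => ?_⟩
  obtain ⟨m, hm⟩ := Nat.rfindOpt_spec (Part.get_mem (hd a))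
  obtain ⟨b, -, hb⟩ := Option.bind_eq_some_iff.1 hm
  split_ifs at hb with hab
  have hba : b = (Nat.rfindOpt (g a)).get (hd a) := Option.some_injective _ hb
  change R a ((Nat.rfindOpt (g a)).get (hd a))
  rwa [← hba]

/-! ### The hypotheses of the learner -/

namespace GridLearner

/-- The `i`-th digit of `h` in base `2 ^ (b + 1)`. -/
def digit (b h i : ℕ) : ℕ := h / (2 ^ (b + 1)) ^ i % 2 ^ (b + 1)

/-- The position of the entry `(i, j)` of the transition matrix of the symbol `s`. -/
def position (k : ℕ) (s : Bool) (i j : ℕ) : ℕ := (cond s (4 * k) 0 + i) * (4 * k) + j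

/-- One step of the weighted automaton with `4 * k` states coded by `h`. -/
def transition (b k h : ℕ) (v : List ℕ) (s : Bool) : List ℕ :=
  (List.range (4 * k)).map fun i => ((List.range (4 * k)).map fun j =>
    digit b h (position k s i j) * v.getD j 0).sum

/-- The initial weights of the automaton coded by `h`. -/
def initial (b k h : ℕ) : List ℕ :=
  (List.range (4 * k)).map fun i => digit b h (2 * (4 * k) * (4 * k) + i)

/-- The sum of the squares of the differences `v_i - v_{2 k + i}`. -/
def finalWeight (k : ℕ) (v : List ℕ) : ℕ :=
  ((List.range (2 * k)).map fun i => (v.getD i 0 - v.getD (2 * k + i) 0) ^ 2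
    + (v.getD (2 * k + i) 0 - v.getD i 0) ^ 2).sum

/-- The weight that the automaton coded by `h` gives to the word `x`. -/
def score (b k h : ℕ) (x : List Bool) : ℕ :=
  finalWeight k (x.foldl (transition b k h) (initial b k h))

/-- The number of bits of the entries of the automata. -/
def precision (n k c : ℕ) : ℕ := 4 * k * (2 * n + 1) + 2 * n + c + 1

/-- The number of fractional bits of the probabilities of the hypotheses. -/
def outputBits (n k c : ℕ) : ℕ := 2 * precision n k c * (n + 1) + c

/-- The number of digits of the code of an automaton. -/
def numDigits (k : ℕ) : ℕ := 2 * (4 * k) * (4 * k) + 4 * k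

/-- The number of automata. -/
def numHyp (n k c : ℕ) : ℕ := (2 ^ (precision n k c + 1)) ^ numDigits k

/-- The list of all words of length `n`. -/
def words : ℕ → List (List Bool)
  | 0 => [[]]
  | n + 1 => (words n).map (List.cons false) ++ (words n).map (List.cons true)

/-- The weights of the automaton coded by `h`, mixed with the uniform distribution. -/
def rawMass (n k c h : ℕ) (x : List Bool) : ℕ :=
  score (precision n k c) k h x * (2 ^ c - 1) + 2 ^ (2 * precision n k c * (n + 1) - n - 1)

/-- The sum of the masses `rawMass` of all words. -/
def totalMass (n k c h : ℕ) : ℕ := ((words n).map (rawMass n k c h)).sum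

/-- The probabilities of the hypothesis `h`, as multiples of `2 ^ (- outputBits n k c)`. -/
def mass (n k c h : ℕ) (x : List Bool) : ℕ :=
  if totalMass n k c h ≤ 2 ^ outputBits n k c then
    rawMass n k c h x +
      if x = (List.range n).map (fun _ => false) then
        2 ^ outputBits n k c - totalMass n k c h else 0
  else 2 ^ (outputBits n k c - n)

/-- The likelihood of a sample under the hypothesis `h`. -/
def likelihood (n k c h : ℕ) (S : List (List Bool)) : ℕ := (S.map (mass n k c h)).prod

/-- The mixing exponent that belongs to the accuracy `e.1 / e.2`. -/
def mixing (e : ℕ × ℕ) : ℕ := 4 * (e.2 / e.1 + 1)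

/-- The circuit `E` computes the hypothesis `h`. -/
def CircuitFor (n k c h : ℕ) (E : EvaluatorCircuit) : Prop :=
  E.2.length = outputBits n k c + 1 ∧
    ∀ y ∈ words n, EvaluatorCircuit.bitsValue (E.outputs y) = mass n k c h y

/-- The hypothesis `h` maximizes the likelihood, and the circuit computes it. -/
def IsOutput (a : LearnerInput) (o : ℕ × EvaluatorCircuit) : Prop :=
  o.1 < numHyp a.1 a.2.1 (mixing a.2.2.1) ∧
    (∀ h < numHyp a.1 a.2.1 (mixing a.2.2.1),
      likelihood a.1 a.2.1 (mixing a.2.2.1) h a.2.2.2.2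
        ≤ likelihood a.1 a.2.1 (mixing a.2.2.1) o.1 a.2.2.2.2) ∧
    CircuitFor a.1 a.2.1 (mixing a.2.2.1) o.1 o.2

/-! ### The search relation is primitive recursive -/

section Computability

open Primrec

variable {α : Type} [Primcodable α]

theorem primrec_digit {b h i : α → ℕ} (hb : Primrec b) (hh : Primrec h) (hi : Primrec i) :
    Primrec fun a => digit (b a) (h a) (i a) := by
  have hB : Primrec fun a => 2 ^ (b a + 1) := nat_pow' (.const 2) (succ.comp hb)
  exact nat_mod.comp (nat_div.comp hh (nat_pow' hB hi)) hB

theorem primrec_position {k i j : α → ℕ} {s : α → Bool} (hk : Primrec k) (hs : Primrec s)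
    (hi : Primrec i) (hj : Primrec j) : Primrec fun a => position (k a) (s a) (i a) (j a) := by
  have hd : Primrec fun a => 4 * k a := nat_mul.comp (.const 4) hk
  exact nat_add.comp (nat_mul.comp (nat_add.comp (Primrec.cond hs hd (.const 0)) hi) hd) hj

theorem primrec_transition {b k h : α → ℕ} {v : α → List ℕ} {s : α → Bool} (hb : Primrec b)
    (hk : Primrec k) (hh : Primrec h) (hv : Primrec v) (hs : Primrec s) :
    Primrec fun a => transition (b a) (k a) (h a) (v a) (s a) := by
  have hd : Primrec fun a => 4 * k a := nat_mul.comp (.const 4) hk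
  refine list_range_map hd (list_sum' (list_range_map (hd.comp fst) (nat_mul.comp ?_ ?_)))
  · have hf := (fst (α := α) (β := ℕ)).comp (fst (α := α × ℕ) (β := ℕ))
    exact primrec_digit (hb.comp hf) (hh.comp hf)
      (primrec_position (hk.comp hf) (hs.comp hf) (snd.comp fst) snd)
  · exact (list_getD 0).comp (hv.comp (fst.comp fst)) snd

theorem primrec_initial {b k h : α → ℕ} (hb : Primrec b) (hk : Primrec k) (hh : Primrec h) :
    Primrec fun a => initial (b a) (k a) (h a) := by
  have hd : Primrec fun a => 4 * k a := nat_mul.comp (.const 4) hk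
  exact list_range_map hd (primrec_digit (hb.comp fst) (hh.comp fst)
    (nat_add.comp ((nat_mul.comp (nat_mul.comp (.const 2) hd) hd).comp fst) snd))

theorem primrec_finalWeight {k : α → ℕ} {v : α → List ℕ} (hk : Primrec k) (hv : Primrec v) :
    Primrec fun a => finalWeight (k a) (v a) := by
  have hd : Primrec fun a => 2 * k a := nat_mul.comp (.const 2) hk
  have h₁ : Primrec fun p : α × ℕ => (v p.1).getD p.2 0 := (list_getD 0).comp (hv.comp fst) snd
  have h₂ : Primrec fun p : α × ℕ => (v p.1).getD (2 * k p.1 + p.2) 0 :=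
    (list_getD 0).comp (hv.comp fst) (nat_add.comp (hd.comp fst) snd)
  exact list_sum' (list_range_map hd (nat_add.comp (nat_pow' (nat_sub.comp h₁ h₂) (.const 2))
    (nat_pow' (nat_sub.comp h₂ h₁) (.const 2))))

theorem primrec_score {b k h : α → ℕ} {x : α → List Bool} (hb : Primrec b) (hk : Primrec k)
    (hh : Primrec h) (hx : Primrec x) : Primrec fun a => score (b a) (k a) (h a) (x a) := by
  refine primrec_finalWeight hk (list_foldl_curried hx (primrec_initial hb hk hh) ?_)
  exact primrec_transition (hb.comp fst) (hk.comp fst) (hh.comp fst) (fst.comp snd) (snd.comp snd)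

theorem primrec_precision {n k c : α → ℕ} (hn : Primrec n) (hk : Primrec k) (hc : Primrec c) :
    Primrec fun a => precision (n a) (k a) (c a) := by
  have hm : Primrec fun a => 2 * n a := nat_mul.comp (.const 2) hn
  exact succ.comp (nat_add.comp (nat_add.comp
    (nat_mul.comp (nat_mul.comp (.const 4) hk) (succ.comp hm)) hm) hc)

theorem primrec_outputBits {n k c : α → ℕ} (hn : Primrec n) (hk : Primrec k) (hc : Primrec c) :
    Primrec fun a => outputBits (n a) (k a) (c a) :=
  nat_add.comp (nat_mul.comp (nat_mul.comp (.const 2) (primrec_precision hn hk hc))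
    (succ.comp hn)) hc

theorem primrec_numHyp {n k c : α → ℕ} (hn : Primrec n) (hk : Primrec k) (hc : Primrec c) :
    Primrec fun a => numHyp (n a) (k a) (c a) := by
  have hd : Primrec fun a => 4 * k a := nat_mul.comp (.const 4) hk
  exact nat_pow' (nat_pow' (.const 2) (succ.comp (primrec_precision hn hk hc)))
    (nat_add.comp (nat_mul.comp (nat_mul.comp (.const 2) hd) hd) hd)

theorem primrec_words : Primrec words := by
  have h : Primrec (Nat.rec [[]] fun _ w =>
      w.map (List.cons false) ++ w.map (List.cons true) : ℕ → List (List Bool)) := by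
    refine nat_rec₁ _ (list_append.comp ?_ ?_)
    · exact list_map snd (list_cons.comp (.const false) snd).to₂
    · exact list_map snd (list_cons.comp (.const true) snd).to₂
  refine h.of_eq fun n => ?_
  induction n with
  | zero => rfl
  | succ n ih => simp only [words, ← ih]

theorem primrec_rawMass {n k c h : α → ℕ} {x : α → List Bool} (hn : Primrec n) (hk : Primrec k)
    (hc : Primrec c) (hh : Primrec h) (hx : Primrec x) :
    Primrec fun a => rawMass (n a) (k a) (c a) (h a) (x a) := by
  have hp := primrec_precision hn hk hc
  refine nat_add.comp (nat_mul.comp (primrec_score hp hk hh hx)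
    (nat_sub.comp (nat_pow' (.const 2) hc) (.const 1))) (nat_pow' (.const 2) (nat_sub.comp
      (nat_sub.comp (nat_mul.comp (nat_mul.comp (.const 2) hp) (succ.comp hn)) hn) (.const 1)))

theorem primrec_totalMass {n k c h : α → ℕ} (hn : Primrec n) (hk : Primrec k)
    (hc : Primrec c) (hh : Primrec h) :
    Primrec fun a => totalMass (n a) (k a) (c a) (h a) :=
  list_sum' (list_map (primrec_words.comp hn) (primrec_rawMass (hn.comp fst) (hk.comp fst)
    (hc.comp fst) (hh.comp fst) snd).to₂)

theorem primrec_mass {n k c h : α → ℕ} {x : α → List Bool} (hn : Primrec n) (hk : Primrec k)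
    (hc : Primrec c) (hh : Primrec h) (hx : Primrec x) :
    Primrec fun a => mass (n a) (k a) (c a) (h a) (x a) := by
  have hB := primrec_outputBits hn hk hc
  have ht := primrec_totalMass hn hk hc hh
  have hp : Primrec fun a => 2 ^ outputBits (n a) (k a) (c a) := nat_pow' (.const 2) hB
  exact Primrec.ite (nat_le.comp ht hp) (nat_add.comp (primrec_rawMass hn hk hc hh hx)
    (Primrec.ite (Primrec.eq.comp hx (list_range_map hn (.const false))) (nat_sub.comp hp ht)
      (.const 0))) (nat_pow' (.const 2) (nat_sub.comp hB hn))

theorem primrec_likelihood {n k c h : α → ℕ} {S : α → List (List Bool)} (hn : Primrec n)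
    (hk : Primrec k) (hc : Primrec c) (hh : Primrec h) (hS : Primrec S) :
    Primrec fun a => likelihood (n a) (k a) (c a) (h a) (S a) :=
  list_prod' (list_map hS (primrec_mass (hn.comp fst) (hk.comp fst) (hc.comp fst) (hh.comp fst)
    snd).to₂)

theorem primrec_mixing : Primrec mixing :=
  nat_mul.comp (.const 4) (succ.comp (nat_div.comp snd fst))

theorem primrec_outputs {E : α → EvaluatorCircuit} {y : α → List Bool} (hE : Primrec E)
    (hy : Primrec y) : Primrec fun a => (E a).outputs (y a) := by
  have hw : Primrec fun a => (E a).wires (y a) := by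
    refine list_foldl_curried (fst.comp hE) hy (list_concat.comp (fst.comp snd) (Primrec.not.comp
      (Primrec.and.comp ?_ ?_)))
    · exact (list_getD false).comp (fst.comp snd) (fst.comp (snd.comp snd))
    · exact (list_getD false).comp (fst.comp snd) (snd.comp (snd.comp snd))
  exact list_map (snd.comp hE) ((list_getD false).comp (hw.comp fst) snd).to₂

theorem primrec_bitsValue {l : α → List Bool} (hl : Primrec l) :
    Primrec fun a => EvaluatorCircuit.bitsValue (l a) :=
  list_foldl_curried hl (.const 0) (nat_add.comp (nat_mul.comp (.const 2) (fst.comp snd))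
    (Primrec.cond (snd.comp snd) (.const 1) (.const 0)))

theorem primrecPred_circuitFor {n k c h : α → ℕ} {E : α → EvaluatorCircuit} (hn : Primrec n)
    (hk : Primrec k) (hc : Primrec c) (hh : Primrec h) (hE : Primrec E) :
    PrimrecPred fun a => CircuitFor (n a) (k a) (c a) (h a) (E a) := by
  refine PrimrecPred.and (Primrec.eq.comp (list_length.comp (snd.comp hE))
    (succ.comp (primrec_outputBits hn hk hc))) ?_
  have h : PrimrecRel fun (y : List Bool) (a : α) =>
      EvaluatorCircuit.bitsValue ((E a).outputs y) = mass (n a) (k a) (c a) (h a) y :=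
    Primrec.eq.comp (primrec_bitsValue (primrec_outputs (hE.comp snd) fst))
      (primrec_mass (hn.comp snd) (hk.comp snd) (hc.comp snd) (hh.comp snd) fst)
  exact h.forall_mem_list.comp (primrec_words.comp hn) Primrec.id

/-- All the arithmetic is in `ℕ`, and the quantifiers range only over the grid and over the words of
length `n`. -/
theorem primrecRel_isOutput : PrimrecRel IsOutput := by
  have hn : Primrec fun a : LearnerInput => a.1 := fst
  have hk : Primrec fun a : LearnerInput => a.2.1 := fst.comp snd
  have hc : Primrec fun a : LearnerInput => mixing a.2.2.1 :=
    primrec_mixing.comp (fst.comp (snd.comp snd))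
  have hS : Primrec fun a : LearnerInput => a.2.2.2.2 := snd.comp (snd.comp (snd.comp snd))
  have ho : Primrec fun p : LearnerInput × (ℕ × EvaluatorCircuit) => p.2.1 := fst.comp snd
  have hN := primrec_numHyp hn hk hc
  have h : PrimrecRel fun (h : ℕ) (p : LearnerInput × (ℕ × EvaluatorCircuit)) =>
      likelihood p.1.1 p.1.2.1 (mixing p.1.2.2.1) h p.1.2.2.2.2
        ≤ likelihood p.1.1 p.1.2.1 (mixing p.1.2.2.1) p.2.1 p.1.2.2.2.2 := by
    have hf : Primrec fun q : ℕ × (LearnerInput × (ℕ × EvaluatorCircuit)) => q.2.1 :=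
      fst.comp snd
    exact nat_le.comp
      (primrec_likelihood (hn.comp hf) (hk.comp hf) (hc.comp hf) fst (hS.comp hf))
      (primrec_likelihood (hn.comp hf) (hk.comp hf) (hc.comp hf) (ho.comp snd) (hS.comp hf))
  have h₁ : PrimrecPred fun p : LearnerInput × (ℕ × EvaluatorCircuit) =>
      p.2.1 < numHyp p.1.1 p.1.2.1 (mixing p.1.2.2.1) := nat_lt.comp ho (hN.comp fst)
  have h₂ : PrimrecPred fun p : LearnerInput × (ℕ × EvaluatorCircuit) =>
      ∀ h < numHyp p.1.1 p.1.2.1 (mixing p.1.2.2.1),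
        likelihood p.1.1 p.1.2.1 (mixing p.1.2.2.1) h p.1.2.2.2.2
          ≤ likelihood p.1.1 p.1.2.1 (mixing p.1.2.2.1) p.2.1 p.1.2.2.2.2 :=
    h.forall_lt_comp (hN.comp fst)
  have h₃ : PrimrecPred fun p : LearnerInput × (ℕ × EvaluatorCircuit) =>
      CircuitFor p.1.1 p.1.2.1 (mixing p.1.2.2.1) p.2.1 p.2.2 :=
    primrecPred_circuitFor (hn.comp fst) (hk.comp fst) (hc.comp fst) ho (snd.comp snd)
  exact h₁.and (h₂.and h₃)

end Computability

end GridLearner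

/-! ### Real weighted automata -/

/-- One step of the weighted automaton with states `0, …, d - 1` and transition matrices `W`. -/
def matStep (d : ℕ) (W : Bool → ℕ → ℕ → ℝ) (v : ℕ → ℝ) (s : Bool) : ℕ → ℝ :=
  fun i => ∑ j ∈ Finset.range d, W s i j * v j

theorem sum_range_two_mul (m : ℕ) (f : ℕ → ℝ) :
    ∑ i ∈ Finset.range (2 * m), f i
      = ∑ i ∈ Finset.range m, f i + ∑ i ∈ Finset.range m, f (m + i) := by
  rw [two_mul, Finset.sum_range_add]

namespace QuantumGenerator

variable {k : ℕ}

/-- The coordinates of a complex vector, extended by zero. -/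
noncomputable def coord (v : EuclideanSpace ℂ (Fin k)) (i : ℕ) : ℂ :=
  if h : i < k then v ⟨i, h⟩ else 0

/-- The real and then the imaginary parts of the coordinates of a complex vector. -/
noncomputable def realCoord (v : EuclideanSpace ℂ (Fin k)) (i : ℕ) : ℝ :=
  if i < k then (coord v i).re else (coord v (i - k)).im

/-- The entries of the matrix `M_s U`, extended by zero. -/
noncomputable def stepEntry (G : QuantumGenerator k Bool) (s : Bool) (i j : ℕ) : ℂ :=
  if h : i < k ∧ j < k then
    (G.projection s * (G.unitary : Matrix (Fin k) (Fin k) ℂ)) ⟨i, h.1⟩ ⟨j, h.2⟩ else 0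

/-- The matrix `M_s U` as a real matrix. -/
noncomputable def realStepEntry (G : QuantumGenerator k Bool) (s : Bool) (i j : ℕ) : ℝ :=
  if i < k then if j < k then (G.stepEntry s i j).re else -(G.stepEntry s i (j - k)).im
  else if j < k then (G.stepEntry s (i - k) j).im else (G.stepEntry s (i - k) (j - k)).re

theorem norm_stepEntry_le (G : QuantumGenerator k Bool) (s : Bool) (i j : ℕ) :
    ‖G.stepEntry s i j‖ ≤ 1 := by
  unfold stepEntry
  split_ifs with h
  · rw [projection, Matrix.diagonal_mul]
    split_ifs
    · rw [one_mul]
      exact entry_norm_bound_of_unitary G.unitary.2 _ _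
    · simp
  · simp

theorem abs_realStepEntry_le (G : QuantumGenerator k Bool) (s : Bool) (i j : ℕ) :
    |G.realStepEntry s i j| ≤ 1 := by
  unfold realStepEntry
  split_ifs <;> try rw [abs_neg]
  all_goals
    first
    | exact (Complex.abs_re_le_norm _).trans (G.norm_stepEntry_le _ _ _)
    | exact (Complex.abs_im_le_norm _).trans (G.norm_stepEntry_le _ _ _)

theorem norm_coord_le (v : EuclideanSpace ℂ (Fin k)) (i : ℕ) : ‖coord v i‖ ≤ ‖v‖ := by
  unfold coord
  split_ifs
  · exact PiLp.norm_apply_le v _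
  · simp

theorem abs_realCoord_le (v : EuclideanSpace ℂ (Fin k)) (i : ℕ) : |realCoord v i| ≤ ‖v‖ := by
  unfold realCoord
  split_ifs
  · exact (Complex.abs_re_le_norm _).trans (norm_coord_le v _)
  · exact (Complex.abs_im_le_norm _).trans (norm_coord_le v _)

theorem coord_step (G : QuantumGenerator k Bool) (v : EuclideanSpace ℂ (Fin k)) (s : Bool)
    (i : ℕ) : coord (G.step v s) i = ∑ j ∈ Finset.range k, G.stepEntry s i j * coord v j := by
  rw [Finset.sum_range]
  by_cases hi : i < k
  · simp [coord, stepEntry, hi, step, Matrix.mulVec, dotProduct]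
  · simp [coord, stepEntry, hi]

/-- A complex entry `z` acts on real and imaginary parts through the block `[[Re z, -Im z], [Im z,
Re z]]`. -/
theorem realCoord_step (G : QuantumGenerator k Bool) (v : EuclideanSpace ℂ (Fin k)) (s : Bool) :
    realCoord (G.step v s) = matStep (2 * k) G.realStepEntry (realCoord v) s := by
  funext i
  rw [matStep, sum_range_two_mul, ← Finset.sum_add_distrib, realCoord, coord_step, coord_step,
    Complex.re_sum, Complex.im_sum]
  split_ifs with hi
  · refine Finset.sum_congr rfl fun j hj => ?_
    have hj := Finset.mem_range.1 hj
    simp [realStepEntry, realCoord, hi, hj]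
    ring
  · refine Finset.sum_congr rfl fun j hj => ?_
    have hj := Finset.mem_range.1 hj
    simp [realStepEntry, realCoord, hi, hj]
    ring

theorem sum_realCoord_sq (v : EuclideanSpace ℂ (Fin k)) :
    ∑ i ∈ Finset.range (2 * k), realCoord v i ^ 2 = ‖v‖ ^ 2 := by
  rw [sum_range_two_mul, ← Finset.sum_add_distrib, Finset.sum_range, EuclideanSpace.norm_sq_eq]
  refine Finset.sum_congr rfl fun i _ => ?_
  simp [realCoord, coord, ← Complex.normSq_eq_norm_sq, Complex.normSq_apply]
  ring

/-- The output probabilities of a quantum generator are computed by a real automaton. -/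
theorem exists_real_automaton (G : QuantumGenerator k Bool) :
    ∃ (R : Bool → ℕ → ℕ → ℝ) (w : ℕ → ℝ), (∀ s i j, |R s i j| ≤ 1) ∧ (∀ i, |w i| ≤ 1) ∧
      ∀ x : List Bool, ∑ i ∈ Finset.range (2 * k), x.foldl (matStep (2 * k) R) w i ^ 2
        = ‖x.foldl G.step G.initialState‖ ^ 2 := by
  refine ⟨G.realStepEntry, realCoord G.initialState, G.abs_realStepEntry_le,
    fun i => (abs_realCoord_le _ i).trans G.norm_initialState.le, fun x => ?_⟩
  rw [← sum_realCoord_sq, List.foldl_hom (g₂ := matStep (2 * k) G.realStepEntry) realCoord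
    fun v s => (G.realCoord_step v s).symm]

end QuantumGenerator

/-- A real automaton is the difference of the two halves of a nonnegative one. -/
theorem exists_nonneg_automaton (m : ℕ) (R : Bool → ℕ → ℕ → ℝ) (w : ℕ → ℝ)
    (hR : ∀ s i j, |R s i j| ≤ 1) (hw : ∀ i, |w i| ≤ 1) :
    ∃ (W : Bool → ℕ → ℕ → ℝ) (v : ℕ → ℝ), (∀ s i j, W s i j ∈ Set.Icc 0 1) ∧
      (∀ i, v i ∈ Set.Icc 0 1) ∧ ∀ (x : List Bool), ∀ i < m,
        x.foldl (matStep (2 * m) W) v i - x.foldl (matStep (2 * m) W) v (m + i)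
          = x.foldl (matStep m R) w i := by
  have hb : ∀ r : ℝ, |r| ≤ 1 → max r 0 ∈ Set.Icc 0 1 ∧ max (-r) 0 ∈ Set.Icc 0 1 := fun r hr => by
    have := abs_le.1 hr
    exact ⟨⟨le_max_right _ _, max_le this.2 zero_le_one⟩,
      ⟨le_max_right _ _, max_le (by linarith) zero_le_one⟩⟩
  have hs : ∀ r : ℝ, max r 0 - max (-r) 0 = r := fun r => by
    rcases le_total r 0 with h | h
    · rw [max_eq_right h, max_eq_left (by linarith)]; ring
    · rw [max_eq_left h, max_eq_right (by linarith)]; ring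
  -- In blocks, `W = [[R⁺, R⁻], [R⁻, R⁺]]`: the difference of the two halves then evolves by `R⁺ -
  -- R⁻ = R`.
  let W : Bool → ℕ → ℕ → ℝ := fun s i j =>
    if i < m then if j < m then max (R s i j) 0 else max (-R s i (j - m)) 0
    else if j < m then max (-R s (i - m) j) 0 else max (R s (i - m) (j - m)) 0
  let v : ℕ → ℝ := fun i => if i < m then max (w i) 0 else max (-w (i - m)) 0
  refine ⟨W, v, fun s i j => ?_, fun i => ?_, fun x => ?_⟩
  · simp only [W]
    split_ifs
    exacts [(hb _ (hR _ _ _)).1, (hb _ (hR _ _ _)).2, (hb _ (hR _ _ _)).2, (hb _ (hR _ _ _)).1]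
  · simp only [v]
    split_ifs
    exacts [(hb _ (hw _)).1, (hb _ (hw _)).2]
  · have hv : ∀ i < m, v i - v (m + i) = w i := fun i hi => by simp [v, hi, hs]
    clear hw
    -- The induction needs only the invariant `v i - v (m + i) = w i`, not the particular initial
    -- vector.
    clear_value v
    induction x generalizing v w with
    | nil => exact hv
    | cons s x ih =>
      refine ih (matStep m R w s) (matStep (2 * m) W v s) fun i hi => ?_
      rw [matStep, matStep, matStep, sum_range_two_mul, sum_range_two_mul,
        ← Finset.sum_add_distrib, ← Finset.sum_add_distrib, ← Finset.sum_sub_distrib]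
      refine Finset.sum_congr rfl fun j hj => ?_
      have hj := Finset.mem_range.1 hj
      rw [← hv j hj]
      simp only [W, hi, hj, if_true, add_lt_iff_neg_left, not_lt_zero, if_false,
        add_tsub_cancel_left]
      linear_combination (v j - v (m + j)) * hs (R s i j)

/-! ### Coding automata by natural numbers -/

namespace GridLearner

theorem exists_digits (β : ℕ) (M : ℕ) (f : ℕ → ℕ) (hf : ∀ i, f i < β) :
    ∃ h < β ^ M, ∀ i < M, h / β ^ i % β = f i := by
  induction M generalizing f with
  | zero => exact ⟨0, by simp, by simp⟩
  | succ M ih =>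
    have hβ : 0 < β := (Nat.zero_le _).trans_lt (hf 0)
    obtain ⟨h, hh, hd⟩ := ih (fun i => f (i + 1)) fun i => hf _
    refine ⟨f 0 + β * h, ?_, fun i hi => ?_⟩
    · rw [pow_succ']
      calc f 0 + β * h < β * (h + 1) := by rw [mul_add]; have := hf 0; omega
        _ ≤ β * β ^ M := Nat.mul_le_mul_left _ hh
    · cases i with
      | zero => simp [Nat.mod_eq_of_lt (hf 0)]
      | succ i =>
        rw [pow_succ', ← Nat.div_div_eq_div_mul, Nat.add_mul_div_left _ _ hβ,
          Nat.div_eq_of_lt (hf 0), zero_add]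
        exact hd i (by omega)

/-- Every table of entries is coded by some number. -/
theorem exists_code (b k : ℕ) (F : Bool → ℕ → ℕ → ℕ) (f : ℕ → ℕ)
    (hF : ∀ s i j, F s i j < 2 ^ (b + 1)) (hf : ∀ i, f i < 2 ^ (b + 1)) :
    ∃ h < (2 ^ (b + 1)) ^ numDigits k,
      (∀ s, ∀ i < 4 * k, ∀ j < 4 * k, digit b h (position k s i j) = F s i j) ∧
      ∀ i < 4 * k, digit b h (2 * (4 * k) * (4 * k) + i) = f i := by
  obtain ⟨d, hd⟩ : ∃ d, d = 4 * k := ⟨_, rfl⟩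
  obtain ⟨h, hh, H⟩ := exists_digits (2 ^ (b + 1)) (numDigits k)
    -- The digits list the matrix of `false`, then that of `true`, both row by row, and then the
    -- initial vector.
    (fun p => if p < 2 * d * d then F (decide (d ≤ p / d)) (p / d % d) (p % d)
      else f (p - 2 * d * d)) fun p => by split_ifs <;> simp only [hF, hf]
  refine ⟨h, hh, fun s i hi j hj => ?_, fun i hi => ?_⟩
  · rw [← hd] at hi hj
    have hpos : 0 < d := by omega
    have hp : position k s i j = j + d * (cond s d 0 + i) := by
      rw [position, ← hd]; ring
    have h₁ : position k s i j / d = cond s d 0 + i := by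
      rw [hp, Nat.add_mul_div_left _ _ hpos, Nat.div_eq_of_lt hj, zero_add]
    have h₂ : position k s i j % d = j := by
      rw [hp, Nat.add_mul_mod_self_left, Nat.mod_eq_of_lt hj]
    have h₃ : position k s i j < 2 * d * d := by
      rw [← Nat.div_lt_iff_lt_mul hpos, h₁]
      cases s <;> simp only [cond_true, cond_false] <;> omega
    have := H (position k s i j) (by rw [numDigits, ← hd]; omega)
    rw [digit, this, if_pos h₃, h₁, h₂]
    cases s
    · simp [Nat.mod_eq_of_lt hi, Nat.not_le.2 hi]
    · simp [Nat.mod_eq_of_lt hi]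
  · rw [digit, H _ (by rw [numDigits]; omega), if_neg (by rw [hd]; omega), hd]
    simp

end GridLearner

/-! ### Error analysis of the rounded automata -/

namespace GridLearner

theorem sum_map_range (n : ℕ) (f : ℕ → ℕ) :
    ((List.range n).map f).sum = ∑ i ∈ Finset.range n, f i := by
  rw [← List.sum_toFinset _ List.nodup_range, List.toFinset_range]

theorem transition_getD {b k h : ℕ} {v : List ℕ} {s : Bool} {i : ℕ} (hi : i < 4 * k) :
    (transition b k h v s).getD i 0
      = ∑ j ∈ Finset.range (4 * k), digit b h (position k s i j) * v.getD j 0 := by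
  simp [transition, List.getD_eq_getElem?_getD, hi, sum_map_range]

theorem initial_getD {b k h i : ℕ} (hi : i < 4 * k) :
    (initial b k h).getD i 0 = digit b h (2 * (4 * k) * (4 * k) + i) := by
  simp [initial, List.getD_eq_getElem?_getD, hi]

/-- Subtraction in `ℕ` is truncated, so at least one of the two squares in each summand vanishes and
their sum is the square of the real difference. -/
theorem finalWeight_cast (k : ℕ) (v : List ℕ) :
    (finalWeight k v : ℝ) = ∑ i ∈ Finset.range (2 * k),
      ((v.getD i 0 : ℝ) - (v.getD (2 * k + i) 0 : ℝ)) ^ 2 := by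
  have h : ∀ a b : ℕ, (((a - b) ^ 2 + (b - a) ^ 2 : ℕ) : ℝ) = ((a : ℝ) - b) ^ 2 := by
    intro a b
    rcases le_total a b with h | h
    · rw [Nat.sub_eq_zero_of_le h]; push_cast [Nat.cast_sub h]; ring
    · rw [Nat.sub_eq_zero_of_le h]; push_cast [Nat.cast_sub h]; ring
  rw [finalWeight, sum_map_range]
  push_cast
  refine Finset.sum_congr rfl fun i _ => ?_
  rw [← h]
  push_cast
  rfl

section Rounding

variable {b k h : ℕ} {W : Bool → ℕ → ℕ → ℝ} {v : ℕ → ℝ}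

/-- The weights of the state `i` after the word `x`, in the rounded automaton. -/
noncomputable def roundedWeight (b k h : ℕ) (x : List Bool) (i : ℕ) : ℝ :=
  ((x.foldl (transition b k h) (initial b k h)).getD i 0 : ℝ) / 2 ^ (b * (x.length + 1))

theorem roundedWeight_nonneg (x : List Bool) (i : ℕ) : 0 ≤ roundedWeight b k h x i := by
  unfold roundedWeight; positivity

theorem roundedWeight_append (x : List Bool) (s : Bool) {i : ℕ} (hi : i < 4 * k) :
    roundedWeight b k h (x ++ [s]) i = ∑ j ∈ Finset.range (4 * k),
      (digit b h (position k s i j) : ℝ) / 2 ^ b * roundedWeight b k h x j := by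
  rw [roundedWeight, List.foldl_append, List.foldl_cons, List.foldl_nil, transition_getD hi,
    Nat.cast_sum, Finset.sum_div]
  refine Finset.sum_congr rfl fun j _ => ?_
  rw [roundedWeight, List.length_append, List.length_singleton, mul_add b (x.length + 1),
    pow_add, mul_one, Nat.cast_mul, div_mul_div_comm, mul_comm ((2 : ℝ) ^ b)]

theorem floor_div_mem {r : ℝ} (hr : 0 ≤ r) (b : ℕ) :
    (⌊2 ^ b * r⌋₊ : ℝ) / 2 ^ b ≤ r ∧ r - (⌊2 ^ b * r⌋₊ : ℝ) / 2 ^ b ≤ 1 / 2 ^ b := by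
  have hp : (0 : ℝ) < 2 ^ b := by positivity
  have h₁ := Nat.floor_le (mul_nonneg hp.le hr)
  have h₂ := Nat.lt_floor_add_one (2 ^ b * r)
  constructor
  · rw [div_le_iff₀ hp]; linarith
  · rw [sub_le_iff_le_add, ← add_div, le_div_iff₀ hp]; linarith

/-- The three bounds are carried together through the induction. Since all entries are nonnegative,
rounding down never increases a weight. One step multiplies the old error by at most `4k` and adds
at most `4k` new errors `2^-b`, each times a weight of size at most `(4k)^l`, where `l` is the
length of the word so far. -/
theorem rounding_error (hW : ∀ s i j, W s i j ∈ Set.Icc 0 1) (hv : ∀ i, v i ∈ Set.Icc 0 1)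
    (hdW : ∀ s, ∀ i < 4 * k, ∀ j < 4 * k, digit b h (position k s i j) = ⌊2 ^ b * W s i j⌋₊)
    (hdv : ∀ i < 4 * k, digit b h (2 * (4 * k) * (4 * k) + i) = ⌊2 ^ b * v i⌋₊)
    (x : List Bool) : ∀ i < 4 * k,
      roundedWeight b k h x i ≤ x.foldl (matStep (4 * k) W) v i ∧
      x.foldl (matStep (4 * k) W) v i ≤ (4 * k : ℝ) ^ x.length ∧
      x.foldl (matStep (4 * k) W) v i - roundedWeight b k h x i
        ≤ (x.length + 1) * (4 * k : ℝ) ^ x.length / 2 ^ b := by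
  induction x using List.reverseRecOn with
  | nil =>
    intro i hi
    have := floor_div_mem (hv i).1 b
    have e : roundedWeight b k h [] i = (⌊2 ^ b * v i⌋₊ : ℝ) / 2 ^ b := by
      rw [roundedWeight, List.foldl_nil, initial_getD hi, hdv i hi]
      simp
    rw [e]
    refine ⟨this.1, by simpa using (hv i).2, by simpa using this.2⟩
  | append_singleton x s ih =>
    intro i hi
    rw [roundedWeight_append x s hi, List.foldl_append, List.foldl_cons, List.foldl_nil, matStep,
      List.length_append, List.length_singleton, ← Finset.sum_sub_distrib]
    have hcard : ∀ c : ℝ, ∑ _j ∈ Finset.range (4 * k), c = 4 * k * c := fun c => by simp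
    refine ⟨Finset.sum_le_sum fun j hj => ?_, ?_, ?_⟩
    · have hj := Finset.mem_range.1 hj
      rw [hdW s i hi j hj]
      exact mul_le_mul (floor_div_mem (hW s i j).1 b).1 (ih j hj).1 (roundedWeight_nonneg _ _)
        (hW s i j).1
    · rw [pow_succ', ← hcard]
      refine Finset.sum_le_sum fun j hj => ?_
      have hj := Finset.mem_range.1 hj
      have h₀ := (roundedWeight_nonneg _ _).trans (ih j hj).1
      nlinarith [(hW s i j).2, (ih j hj).2.1]
    · have : (((x.length + 1 : ℕ) : ℝ) + 1) * (4 * k : ℝ) ^ (x.length + 1) / 2 ^ b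
          = 4 * k * ((4 * k : ℝ) ^ x.length / 2 ^ b
            + (x.length + 1) * (4 * k : ℝ) ^ x.length / 2 ^ b) := by
        push_cast; ring
      rw [this, ← hcard]
      refine Finset.sum_le_sum fun j hj => ?_
      have hj := Finset.mem_range.1 hj
      rw [hdW s i hi j hj]
      obtain ⟨h₁, h₂, h₃⟩ := ih j hj
      obtain ⟨g₁, g₂⟩ := floor_div_mem (hW s i j).1 b
      have h₀ := roundedWeight_nonneg (b := b) (k := k) (h := h) x j
      set V := x.foldl (matStep (4 * k) W) v j
      set U := roundedWeight b k h x j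
      set w := (⌊2 ^ b * W s i j⌋₊ : ℝ) / 2 ^ b
      have hw : 0 ≤ w := by positivity
      have e : W s i j * V - w * U = (W s i j - w) * V + w * (V - U) := by ring
      rw [e]
      refine add_le_add ?_ ?_
      · calc (W s i j - w) * V ≤ 1 / 2 ^ b * (4 * k : ℝ) ^ x.length :=
            mul_le_mul g₂ h₂ (h₀.trans h₁) (by positivity)
          _ = _ := by ring
      · exact (mul_le_of_le_one_left (by linarith) (g₁.trans (hW s i j).2)).trans h₃

theorem score_div_eq (x : List Bool) : (score b k h x : ℝ) / 2 ^ (2 * b * (x.length + 1))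
    = ∑ i ∈ Finset.range (2 * k),
      (roundedWeight b k h x i - roundedWeight b k h x (2 * k + i)) ^ 2 := by
  rw [score, finalWeight_cast, Finset.sum_div]
  refine Finset.sum_congr rfl fun i _ => ?_
  rw [roundedWeight, roundedWeight, ← sub_div, div_pow, ← pow_mul]
  congr 2
  ring

theorem abs_score_sub_le (hW : ∀ s i j, W s i j ∈ Set.Icc 0 1) (hv : ∀ i, v i ∈ Set.Icc 0 1)
    (hdW : ∀ s, ∀ i < 4 * k, ∀ j < 4 * k, digit b h (position k s i j) = ⌊2 ^ b * W s i j⌋₊)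
    (hdv : ∀ i < 4 * k, digit b h (2 * (4 * k) * (4 * k) + i) = ⌊2 ^ b * v i⌋₊)
    (x : List Bool) :
    |(score b k h x : ℝ) / 2 ^ (2 * b * (x.length + 1)) - ∑ i ∈ Finset.range (2 * k),
      (x.foldl (matStep (4 * k) W) v i - x.foldl (matStep (4 * k) W) v (2 * k + i)) ^ 2|
      ≤ (x.length + 1) * (4 * k : ℝ) ^ (2 * x.length + 1) / 2 ^ b := by
  rw [score_div_eq, ← Finset.sum_sub_distrib]
  have key := rounding_error hW hv hdW hdv x
  have : ((x.length : ℝ) + 1) * (4 * k : ℝ) ^ (2 * x.length + 1) / 2 ^ b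
      = ∑ _i ∈ Finset.range (2 * k), ((x.length + 1) * (4 * k : ℝ) ^ x.length / 2 ^ b)
        * (2 * (4 * k : ℝ) ^ x.length) := by
    rw [Finset.sum_const, Finset.card_range, nsmul_eq_mul]
    push_cast
    ring
  rw [this]
  refine (Finset.abs_sum_le_sum_abs _ _).trans (Finset.sum_le_sum fun i hi => ?_)
  have hi := Finset.mem_range.1 hi
  obtain ⟨a₁, a₂, a₃⟩ := key i (by omega)
  obtain ⟨c₁, c₂, c₃⟩ := key (2 * k + i) (by omega)
  have a₀ := roundedWeight_nonneg (b := b) (k := k) (h := h) x i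
  have c₀ := roundedWeight_nonneg (b := b) (k := k) (h := h) x (2 * k + i)
  -- Both rounding errors are nonnegative, so their difference obeys the bound of a single one; the
  -- other factor is a sum of two differences of weights in `[0, (4k)^l]`, with `l` the length of
  -- `x`.
  rw [sq_sub_sq, abs_mul, mul_comm]
  refine mul_le_mul ?_ ?_ (abs_nonneg _) (by positivity) <;> rw [abs_le] <;>
    constructor <;> linarith

end Rounding

/-- The crude bounds `n + 1 ≤ 2^n` and `4k ≤ 2^(4k)` make the exponents add up exactly to `precision
n k c`. -/
theorem precision_bound (n k c : ℕ) :
    ((n : ℝ) + 1) * (4 * k : ℝ) ^ (2 * n + 1) / 2 ^ precision n k c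
      ≤ 1 / 2 ^ (n + c + 1) := by
  have h₁ : ((n : ℝ) + 1) ≤ 2 ^ n := by exact_mod_cast Nat.lt_two_pow_self
  have h₂ : (4 * k : ℝ) ≤ 2 ^ (4 * k) := by exact_mod_cast Nat.lt_two_pow_self.le
  rw [div_le_div_iff₀ (by positivity) (by positivity), one_mul]
  calc ((n : ℝ) + 1) * (4 * k : ℝ) ^ (2 * n + 1) * 2 ^ (n + c + 1)
      ≤ 2 ^ n * (2 ^ (4 * k)) ^ (2 * n + 1) * 2 ^ (n + c + 1) := by gcongr
    _ = 2 ^ precision n k c := by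
      rw [← pow_mul, ← pow_add, ← pow_add]
      congr 1
      rw [precision]
      ring

/-- Some automaton of the grid approximates the output probabilities of a generator. -/
theorem exists_score_close {k : ℕ} (G : QuantumGenerator k Bool) (n c : ℕ) :
    ∃ h < numHyp n k c, ∀ x : Fin n → Bool,
      |(score (precision n k c) k h (List.ofFn x) : ℝ) / 2 ^ (2 * precision n k c * (n + 1))
        - G.prob x| ≤ 1 / 2 ^ (n + c + 1) := by
  obtain ⟨R, w, hR, hw, hG⟩ := G.exists_real_automaton
  obtain ⟨W, v, hW, hv, hd⟩ := exists_nonneg_automaton (2 * k) R w hR hw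
  rw [show 2 * (2 * k) = 4 * k by ring] at hd
  -- The entry `1` rounds to `2^b` itself, which is why digits have base `2^(b+1)`.
  have hfl : ∀ r : ℝ, r ∈ Set.Icc (0 : ℝ) 1 →
      ⌊2 ^ precision n k c * r⌋₊ < 2 ^ (precision n k c + 1) := by
    intro r hr
    rw [Nat.floor_lt (mul_nonneg (by positivity) hr.1)]
    push_cast
    rw [pow_succ]
    nlinarith [hr.2, show (0 : ℝ) < 2 ^ precision n k c by positivity]
  obtain ⟨h, hh, hdW, hdv⟩ := exists_code (precision n k c) k
    (fun s i j => ⌊2 ^ precision n k c * W s i j⌋₊) (fun i => ⌊2 ^ precision n k c * v i⌋₊)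
    (fun s i j => hfl _ (hW s i j)) fun i => hfl _ (hv i)
  refine ⟨h, hh, fun x => ?_⟩
  have e := abs_score_sub_le hW hv hdW hdv (List.ofFn x)
  rw [List.length_ofFn] at e
  refine (le_of_eq ?_).trans (e.trans (precision_bound n k c))
  rw [QuantumGenerator.prob, ← hG]
  congr 2
  exact Finset.sum_congr rfl fun i hi => by rw [hd _ _ (Finset.mem_range.1 hi)]

end GridLearner

/-! ### The hypotheses as probability distributions -/

namespace GridLearner

theorem sum_map_words {M : Type} [AddCommMonoid M] (n : ℕ) (f : List Bool → M) :
    ((words n).map f).sum = ∑ x : Fin n → Bool, f (List.ofFn x) := by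
  induction n generalizing f with
  | zero => simp [words]
  | succ n ih =>
    rw [← (Fin.consEquiv fun _ => Bool).sum_comp, Fintype.sum_prod_type]
    simp [words, Function.comp_def, ih, Fin.consEquiv, List.ofFn_succ, add_comm]

theorem exists_ofFn_of_mem_words {n : ℕ} {y : List Bool} (hy : y ∈ words n) :
    ∃ x : Fin n → Bool, List.ofFn x = y := by
  suffices h : y.length = n by
    subst h
    exact ⟨y.get, List.ofFn_get y⟩
  induction n generalizing y with
  | zero => simpa [words] using hy
  | succ n ih =>
    simp only [words, List.mem_append, List.mem_map] at hy
    rcases hy with ⟨z, hz, rfl⟩ | ⟨z, hz, rfl⟩ <;> simp [ih hz]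

theorem ofFn_mem_words {n : ℕ} (x : Fin n → Bool) : List.ofFn x ∈ words n := by
  induction n with
  | zero => simp [words]
  | succ n ih =>
    rw [List.ofFn_succ]
    simp only [words, List.mem_append, List.mem_map]
    cases x 0
    · exact Or.inl ⟨_, ih _, rfl⟩
    · exact Or.inr ⟨_, ih _, rfl⟩

variable (n k c h : ℕ)

theorem le_two_mul_precision : n + 1 ≤ 2 * precision n k c * (n + 1) :=
  Nat.le_mul_of_pos_left _ (by rw [precision]; omega)

/-- Every code must yield a distribution, including those that approximate no generator: a deficit
is given to the all-`false` word, and an excess is answered by the uniform distribution. -/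
theorem sum_mass :
    ∑ x : Fin n → Bool, mass n k c h (List.ofFn x) = 2 ^ outputBits n k c := by
  have hn : n ≤ outputBits n k c := by
    have := le_two_mul_precision n k c
    rw [outputBits]; omega
  by_cases ht : totalMass n k c h ≤ 2 ^ outputBits n k c
  · have hz : ∀ x : Fin n → Bool, List.ofFn x = (List.range n).map (fun _ => false)
        ↔ x = fun _ => false := fun x => by
      rw [← List.ofFn_inj]
      have : (List.range n).map (fun _ => false) = List.ofFn fun _ : Fin n => false := by
        simp [List.map_const', List.ofFn_const]
      rw [this]
    simp_rw [mass, if_pos ht, hz]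
    rw [Finset.sum_add_distrib, Finset.sum_ite_eq' Finset.univ, if_pos (Finset.mem_univ _),
      ← sum_map_words n (rawMass n k c h)]
    exact Nat.add_sub_cancel' ht
  · simp_rw [mass, if_neg ht]
    simp [← pow_add, Nat.add_sub_cancel' hn]

theorem mass_le (x : Fin n → Bool) : mass n k c h (List.ofFn x) ≤ 2 ^ outputBits n k c := by
  rw [← sum_mass n k c h]
  exact Finset.single_le_sum (f := fun x : Fin n → Bool => mass n k c h (List.ofFn x))
    (fun _ _ => Nat.zero_le _) (Finset.mem_univ x)

/-- The probability of the word `x` under the hypothesis `h`. -/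
noncomputable def hypProb {n : ℕ} (k c h : ℕ) (x : Fin n → Bool) : ℝ :=
  (mass n k c h (List.ofFn x) : ℝ) / 2 ^ outputBits n k c

variable {n}

theorem hypProb_nonneg (x : Fin n → Bool) : 0 ≤ hypProb k c h x := by
  unfold hypProb; positivity

theorem sum_hypProb : ∑ x : Fin n → Bool, hypProb k c h x = 1 := by
  simp_rw [hypProb]
  rw [← Finset.sum_div, ← Nat.cast_sum, sum_mass]
  simp

theorem hypProb_le_one (x : Fin n → Bool) : hypProb k c h x ≤ 1 := by
  rw [← sum_hypProb k c h]
  exact Finset.single_le_sum (f := fun x : Fin n → Bool => hypProb k c h x)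
    (fun _ _ => hypProb_nonneg k c h _) (Finset.mem_univ x)

/-- The real form of the integer definition; the exponent in `rawMass` is not truncated, by
`le_two_mul_precision`. -/
theorem rawMass_div (x : List Bool) :
    (rawMass n k c h x : ℝ) / 2 ^ outputBits n k c
      = (score (precision n k c) k h x : ℝ) / 2 ^ (2 * precision n k c * (n + 1))
          * (1 - 1 / 2 ^ c) + 1 / 2 ^ (n + c + 1) := by
  have hp := le_two_mul_precision n k c
  obtain ⟨r, hr⟩ := Nat.exists_eq_add_of_le' hp
  have hc : ((2 ^ c - 1 : ℕ) : ℝ) = 2 ^ c - 1 := by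
    rw [Nat.cast_sub Nat.one_le_two_pow]; simp
  rw [rawMass, outputBits, hr, show r + (n + 1) - n - 1 = r by omega]
  push_cast [hc]
  field_simp
  ring

theorem rawMass_le_mass (ht : totalMass n k c h ≤ 2 ^ outputBits n k c) (x : List Bool) :
    rawMass n k c h x ≤ mass n k c h x := by
  rw [mass, if_pos ht]
  exact Nat.le_add_right _ _

/-- The uniform part gives this in the main case, and the fallback has the larger value `2^-n`. The
bound keeps the log-likelihoods bounded, as Hoeffding's inequality requires. -/
theorem le_hypProb (x : Fin n → Bool) : 1 / 2 ^ (n + c + 1) ≤ hypProb k c h x := by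
  have hp := le_two_mul_precision n k c
  by_cases ht : totalMass n k c h ≤ 2 ^ outputBits n k c
  · calc (1 : ℝ) / 2 ^ (n + c + 1)
        ≤ (rawMass n k c h (List.ofFn x) : ℝ) / 2 ^ outputBits n k c := by
          rw [rawMass_div]
          have : (1 : ℝ) / 2 ^ c ≤ 1 := by
            rw [div_le_one (by positivity)]
            exact one_le_pow₀ one_le_two
          have h₁ : (0 : ℝ) ≤ 1 - 1 / 2 ^ c := by linarith
          exact le_add_of_nonneg_left (by positivity)
      _ ≤ hypProb k c h x := by
          rw [hypProb]
          gcongr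
          exact_mod_cast rawMass_le_mass k c h ht _
  · rw [hypProb, mass, if_neg ht, div_le_div_iff₀ (by positivity) (by positivity)]
    push_cast
    rw [one_mul, ← pow_add]
    exact pow_le_pow_right₀ one_le_two (by rw [outputBits]; omega)

theorem hypProb_pos (x : Fin n → Bool) : 0 < hypProb k c h x :=
  lt_of_lt_of_le (by positivity) (le_hypProb k c h x)

/-- The distribution of the hypothesis `h`. -/
noncomputable def hypDist (n k c h : ℕ) : PMF (Fin n → Bool) :=
  PMF.ofFintype (fun x => ENNReal.ofReal (hypProb k c h x)) (by
    rw [← ENNReal.ofReal_sum_of_nonneg fun x _ => hypProb_nonneg k c h x, sum_hypProb]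
    simp)

theorem hypDist_toReal (x : Fin n → Bool) : (hypDist n k c h x).toReal = hypProb k c h x := by
  simp [hypDist, ENNReal.toReal_ofReal (hypProb_nonneg k c h x)]

theorem prob_toReal {k : ℕ} (G : QuantumGenerator k Bool) (x : Fin n → Bool) :
    (G.outputDist n x).toReal = G.prob x := by
  have : 0 ≤ G.prob x := by unfold QuantumGenerator.prob; positivity
  simp [QuantumGenerator.outputDist, ENNReal.toReal_ofReal this]

theorem sum_prob {k : ℕ} (G : QuantumGenerator k Bool) : ∑ x : Fin n → Bool, G.prob x = 1 := by
  simp only [QuantumGenerator.prob]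
  rw [G.sum_norm_foldl_sq n, G.norm_initialState, one_pow]

/-- The grid contains a hypothesis that dominates a multiple of the target. -/
theorem exists_hypProb_ge {k : ℕ} (G : QuantumGenerator k Bool) (n c : ℕ) :
    ∃ h < numHyp n k c, ∀ x : Fin n → Bool, (1 - 1 / 2 ^ c) * G.prob x ≤ hypProb k c h x := by
  obtain ⟨h, hh, hs⟩ := exists_score_close G n c
  refine ⟨h, hh, fun x => ?_⟩
  have hc₀ : (0 : ℝ) < 1 / 2 ^ c := by positivity
  have hc₁ : (1 : ℝ) / 2 ^ c ≤ 1 := by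
    rw [div_le_one (by positivity)]
    exact one_le_pow₀ one_le_two
  have ht : totalMass n k c h ≤ 2 ^ outputBits n k c := by
    have e : (totalMass n k c h : ℝ) / 2 ^ outputBits n k c ≤ 1 := by
      rw [totalMass, sum_map_words, Nat.cast_sum, Finset.sum_div]
      calc ∑ x : Fin n → Bool, (rawMass n k c h (List.ofFn x) : ℝ) / 2 ^ outputBits n k c
          ≤ ∑ x : Fin n → Bool, ((G.prob x + 1 / 2 ^ (n + c + 1)) * (1 - 1 / 2 ^ c)
              + 1 / 2 ^ (n + c + 1)) := by
            refine Finset.sum_le_sum fun x _ => ?_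
            rw [rawMass_div]
            gcongr
            linarith [(abs_le.1 (hs x)).2]
        _ = (1 + 1 / 2 * (1 / 2 ^ c)) * (1 - 1 / 2 ^ c) + 1 / 2 * (1 / 2 ^ c) := by
            rw [Finset.sum_add_distrib, ← Finset.sum_mul, Finset.sum_add_distrib, sum_prob]
            simp only [Finset.sum_const, Finset.card_univ, Fintype.card_pi, Fintype.card_bool,
              Finset.prod_const, Fintype.card_fin, nsmul_eq_mul]
            push_cast
            rw [show (2 : ℝ) ^ n * (1 / 2 ^ (n + c + 1)) = 1 / 2 * (1 / 2 ^ c) by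
              field_simp; ring]
        -- With `γ = 2^-c` the left side equals `1 - γ^2 / 2`.
        _ ≤ 1 := by nlinarith
    rw [div_le_one (by positivity)] at e
    exact_mod_cast e
  calc (1 - 1 / 2 ^ c) * G.prob x
      ≤ (rawMass n k c h (List.ofFn x) : ℝ) / 2 ^ outputBits n k c := by
        rw [rawMass_div]
        -- The rounding loss is at most `2^-(n+c+1)` before scaling by `1 - 2^-c`, so the added
        -- uniform term outweighs it.
        have h₁ := (abs_le.1 (hs x)).1
        have h₂ : (0 : ℝ) < 1 / 2 ^ (n + c + 1) := by positivity
        nlinarith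
    _ ≤ hypProb k c h x := by
        rw [hypProb]
        gcongr
        exact_mod_cast rawMass_le_mass k c h ht _

/-! ### Existence and meaning of the output -/

theorem exists_isOutput (a : LearnerInput) : ∃ o, IsOutput a o := by
  obtain ⟨n, k, e, d, S⟩ := a
  obtain ⟨h, hh, hm⟩ := Finset.exists_max_image (Finset.range (numHyp n k (mixing e)))
    (fun h => likelihood n k (mixing e) h S) ⟨0, by simp [numHyp]⟩
  obtain ⟨E, hE, hv⟩ := EvaluatorCircuit.exists_bitsValue_outputs_eq
    (outputBits n k (mixing e) + 1) (fun y : Fin n → Bool => mass n k (mixing e) h (List.ofFn y))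
    fun y => (mass_le n k (mixing e) h y).trans_lt (Nat.pow_lt_pow_right one_lt_two (by omega))
  refine ⟨(h, E), Finset.mem_range.1 hh, fun h' hh' => hm h' (Finset.mem_range.2 hh'), hE,
    fun y hy => ?_⟩
  obtain ⟨x, rfl⟩ := exists_ofFn_of_mem_words hy
  exact hv x

theorem CircuitFor.computes {k c h : ℕ} {E : EvaluatorCircuit} (hE : CircuitFor n k c h E) :
    E.Computes (hypDist n k c h) := fun y => by
  rw [hypDist_toReal, EvaluatorCircuit.value_eq E hE.1, hE.2 _ (ofFn_mem_words y), hypProb]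

/-- The scaling factor does not depend on `h`, so comparing integer likelihoods compares the real
ones. -/
theorem likelihood_ofFn {m : ℕ} (x : Fin m → Fin n → Bool) :
    (likelihood n k c h (List.ofFn fun i => List.ofFn (x i)) : ℝ)
      = (∏ i, hypProb k c h (x i)) * (2 ^ outputBits n k c) ^ m := by
  have e : ∀ i, (mass n k c h (List.ofFn (x i)) : ℝ)
      = hypProb k c h (x i) * 2 ^ outputBits n k c := fun i => by
    rw [hypProb]; field_simp
  rw [likelihood, List.map_ofFn, List.prod_ofFn]
  push_cast
  simp [e, Finset.prod_mul_distrib]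

theorem sum_log_hypProb_le {k c h h' m : ℕ} {x : Fin m → Fin n → Bool}
    (hl : likelihood n k c h (List.ofFn fun i => List.ofFn (x i))
      ≤ likelihood n k c h' (List.ofFn fun i => List.ofFn (x i))) :
    ∑ i, Real.log (hypProb k c h (x i)) ≤ ∑ i, Real.log (hypProb k c h' (x i)) := by
  rw [← Real.log_prod fun i _ => (hypProb_pos k c h (x i)).ne',
    ← Real.log_prod fun i _ => (hypProb_pos k c h' (x i)).ne']
  refine Real.log_le_log (Finset.prod_pos fun i _ => hypProb_pos k c h (x i)) ?_
  have := Nat.cast_le (α := ℝ).2 hl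
  rw [likelihood_ofFn, likelihood_ofFn] at this
  exact le_of_mul_le_mul_right this (by positivity)

end GridLearner

/-! ### Concentration and the Kullback-Leibler divergence on finite types -/

section Finite

variable {α : Type} [Fintype α] [MeasurableSpace α] [MeasurableSingletonClass α]

/-- Hoeffding's inequality for a sample sum whose summands have mean at most `-r`. -/
theorem measureReal_pi_sum_nonneg_le (D : Measure α) [IsProbabilityMeasure D] (g : α → ℝ)
    {L r : ℝ} (hL : 0 ≤ L) (hr : 0 ≤ r) (hg : ∀ a, g a ∈ Set.Icc (-L) L)
    (hmean : ∫ a, g a ∂D ≤ -r) (m : ℕ) :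
    (Measure.pi fun _ : Fin m => D).real {x | 0 ≤ ∑ i, g (x i)}
      ≤ Real.exp (-(m * r) ^ 2 / (2 * (m * L ^ 2))) := by
  have hm : ∀ f : α → ℝ, Measurable f := fun f => measurable_of_finite f
  -- Hoeffding's lemma: a variable in an interval of length `2L`, once centered, is sub-Gaussian
  -- with parameter `L^2`.
  have hsub := ProbabilityTheory.hasSubgaussianMGF_of_mem_Icc (μ := D) (X := g) (a := -L) (b := L)
    (hm g).aemeasurable (Filter.Eventually.of_forall hg)
  have hind : ProbabilityTheory.iIndepFun
      (fun (i : Fin m) (x : Fin m → α) => g (x i) - ∫ a, g a ∂D) (Measure.pi fun _ => D) :=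
    ProbabilityTheory.iIndepFun_pi (X := fun _ a => g a - ∫ a, g a ∂D)
      fun _ => (hm _).aemeasurable
  have key := ProbabilityTheory.HasSubgaussianMGF.measure_sum_ge_le_of_iIndepFun hind
    (c := fun _ => (‖L - -L‖₊ / 2) ^ 2) (s := Finset.univ) (fun i _ => by
      have e := (measurePreserving_eval (fun _ : Fin m => D) i).map_eq
      rw [← e] at hsub
      have := ProbabilityTheory.HasSubgaussianMGF.of_map (μ := Measure.pi fun _ : Fin m => D)
        (Y := Function.eval i) (measurable_pi_apply i).aemeasurable hsub
      rwa [e] at this) (ε := m * r) (by positivity)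
  refine (measureReal_mono fun x hx => ?_).trans (key.trans (le_of_eq ?_))
  · simp only [Set.mem_ofPred_eq, Finset.sum_sub_distrib, Finset.sum_const, Finset.card_univ,
      Fintype.card_fin, nsmul_eq_mul] at hx ⊢
    nlinarith [mul_le_mul_of_nonneg_left hmean (Nat.cast_nonneg (α := ℝ) m)]
  · have : (‖L - -L‖ / 2) ^ 2 = L ^ 2 := by
      rw [Real.norm_of_nonneg (by linarith)]; ring
    simp only [Finset.sum_const, Finset.card_univ, Fintype.card_fin, nsmul_eq_mul]
    push_cast
    rw [this]

/-- As `Q` charges every point, `D` has the density `D a / Q a` with respect to `Q`, and the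
log-likelihood ratio is explicit. -/
theorem PMF.klDiv_toMeasure_eq (D Q : PMF α) (hQ : ∀ a, Q a ≠ 0) :
    InformationTheory.klDiv D.toMeasure Q.toMeasure
      = ENNReal.ofReal (∑ a, (D a).toReal * Real.log ((D a).toReal / (Q a).toReal)) := by
  have hs : ∀ a, (Q a) * (D a / Q a) = D a := fun a =>
    ENNReal.mul_div_cancel (hQ a) (Q.apply_ne_top a)
  have hd : D.toMeasure = Q.toMeasure.withDensity fun a => D a / Q a := by
    refine Measure.ext_of_singleton fun a => ?_
    rw [withDensity_apply _ (measurableSet_singleton a), lintegral_singleton,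
      PMF.toMeasure_apply_singleton _ _ (measurableSet_singleton a),
      PMF.toMeasure_apply_singleton _ _ (measurableSet_singleton a), mul_comm, hs]
  have hac : D.toMeasure ≪ Q.toMeasure := by
    rw [hd]; exact withDensity_absolutelyContinuous _ _
  have hrn : D.toMeasure.rnDeriv Q.toMeasure =ᵐ[D.toMeasure] fun a => D a / Q a := by
    have h := Measure.rnDeriv_withDensity Q.toMeasure (measurable_of_finite fun a => D a / Q a)
    rw [← hd] at h
    exact hac.ae_le h
  have hllr : llr D.toMeasure Q.toMeasure =ᵐ[D.toMeasure]
      fun a => Real.log ((D a).toReal / (Q a).toReal) := by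
    filter_upwards [hrn] with a ha
    rw [llr, ha, ENNReal.toReal_div]
  rw [InformationTheory.klDiv_of_ac_of_integrable hac
    ((integrable_congr hllr).2 Integrable.of_finite), integral_congr_ae hllr,
    PMF.integral_eq_sum]
  simp

end Finite

/-! ### Maximum likelihood on the grid -/

namespace GridLearner

variable {n k : ℕ}

theorem log_hypProb_mem_Icc (c h : ℕ) (x : Fin n → Bool) :
    Real.log (hypProb k c h x) ∈ Set.Icc (-((n : ℝ) + c + 1)) 0 := by
  have hp := hypProb_pos k c h x
  refine ⟨?_, Real.log_nonpos hp.le (hypProb_le_one k c h x)⟩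
  have h₁ := Real.log_le_log (by positivity) (le_hypProb k c h x)
  rw [one_div, Real.log_inv, Real.log_pow] at h₁
  push_cast at h₁
  nlinarith [Real.log_two_lt_d9, show (0 : ℝ) ≤ n + c + 1 by positivity]

/-- The divergence of the hypothesis `h` from the target. -/
noncomputable def divergence (G : QuantumGenerator k Bool) (n c h : ℕ) : ℝ :=
  ∑ x : Fin n → Bool, G.prob x * Real.log (G.prob x / hypProb k c h x)

theorem prob_nonneg (G : QuantumGenerator k Bool) (x : Fin n → Bool) : 0 ≤ G.prob x := by
  unfold QuantumGenerator.prob; positivity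

theorem klDiv_hypDist (G : QuantumGenerator k Bool) (n c h : ℕ) :
    InformationTheory.klDiv (G.outputDist n).toMeasure (hypDist n k c h).toMeasure
      = ENNReal.ofReal (divergence G n c h) := by
  rw [PMF.klDiv_toMeasure_eq _ _ fun x hx => ?_]
  · simp_rw [prob_toReal, hypDist_toReal]
    rfl
  · have := hypDist_toReal k c h x
    rw [hx] at this
    exact (hypProb_pos k c h x).ne this

/-- The entropy of the target cancels, leaving the mean of a log-likelihood ratio, which samples can
estimate. -/
theorem divergence_sub (G : QuantumGenerator k Bool) (n c h h' : ℕ) :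
    divergence G n c h - divergence G n c h' = ∑ x : Fin n → Bool,
      G.prob x * (Real.log (hypProb k c h' x) - Real.log (hypProb k c h x)) := by
  rw [divergence, divergence, ← Finset.sum_sub_distrib]
  refine Finset.sum_congr rfl fun x _ => ?_
  rcases eq_or_ne (G.prob x) 0 with h0 | h0
  · simp [h0]
  · rw [Real.log_div h0 (hypProb_pos k c h x).ne', Real.log_div h0 (hypProb_pos k c h' x).ne']
    ring

/-- For `γ = 2^-c ≤ 1/2` one has `(1 + 2γ)(1 - γ) ≥ 1`, so domination gives `p / q ≤ 1 + 2γ`; then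
`log t ≤ t - 1`. -/
theorem divergence_le {G : QuantumGenerator k Bool} {n c h : ℕ} (hc : 1 ≤ c)
    (hh : ∀ x : Fin n → Bool, (1 - 1 / 2 ^ c) * G.prob x ≤ hypProb k c h x) :
    divergence G n c h ≤ 2 * (1 / 2 ^ c) := by
  have hγ : (1 : ℝ) / 2 ^ c ≤ 1 / 2 := by
    rw [div_le_div_iff₀ (by positivity) (by positivity)]
    simpa using pow_le_pow_right₀ (one_le_two (α := ℝ)) hc
  have hγ₀ : (0 : ℝ) < 1 / 2 ^ c := by positivity
  set γ : ℝ := 1 / 2 ^ c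
  calc divergence G n c h ≤ ∑ x : Fin n → Bool, G.prob x * (2 * γ) := by
        refine Finset.sum_le_sum fun x _ => ?_
        rcases (prob_nonneg G x).eq_or_lt with h0 | h0
        · simp [← h0]
        refine mul_le_mul_of_nonneg_left ?_ h0.le
        have hq := hypProb_pos k c h x
        refine (Real.log_le_sub_one_of_pos (by positivity)).trans ?_
        rw [sub_le_iff_le_add, div_le_iff₀ hq]
        have := mul_le_mul_of_nonneg_left (hh x) (show 0 ≤ 2 * γ + 1 by linarith)
        nlinarith [mul_nonneg h0.le (mul_nonneg hγ₀.le (show 0 ≤ 1 - 2 * γ by linarith))]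
    _ = 2 * γ := by rw [← Finset.sum_mul, sum_prob, one_mul]

/-- The union bound: with `L = n + c + 1` the Hoeffding exponent is `-m ε^2 / (8 L^2)`, and the
assumed sample size makes it beat the logarithm of the grid size plus `log (1/δ)`. -/
theorem numHyp_mul_exp_le {n k c m : ℕ} {ε δ : ℝ} (hε : 0 < ε) (hδ : 0 < δ)
    (hm : 8 * ((n : ℝ) + c + 1) ^ 2 * (1 / ε) ^ 2 *
      ((precision n k c + 1) * numDigits k + Real.log (1 / δ)) ≤ m) :
    numHyp n k c * Real.exp (-(m * (ε / 2)) ^ 2 / (2 * (m * ((n : ℝ) + c + 1) ^ 2))) ≤ δ := by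
  set L : ℝ := (n : ℝ) + c + 1 with hL
  have hLpos : 0 < L := by positivity
  set K : ℝ := (precision n k c + 1) * numDigits k with hK
  have hN : (numHyp n k c : ℝ) ≤ Real.exp K := by
    have h2 : (2 : ℝ) ≤ Real.exp 1 := by linarith [Real.add_one_le_exp 1]
    calc (numHyp n k c : ℝ) = 2 ^ ((precision n k c + 1) * numDigits k) := by
          rw [numHyp, pow_mul]; push_cast; rfl
      _ ≤ Real.exp 1 ^ ((precision n k c + 1) * numDigits k) := by gcongr
      _ = Real.exp K := by rw [← Real.exp_nat_mul, hK]; push_cast; ring_nf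
  have he : -(m * (ε / 2)) ^ 2 / (2 * (m * L ^ 2)) = -(m * (ε ^ 2 / (8 * L ^ 2))) := by
    -- For `m = 0` the quotient is `0 / 0 = 0`, so the identity still holds.
    rcases eq_or_ne (m : ℝ) 0 with h0 | h0
    · simp [h0]
    · field_simp; norm_num
  have hb : K + Real.log (1 / δ) ≤ m * (ε ^ 2 / (8 * L ^ 2)) := by
    have h := mul_le_mul_of_nonneg_right hm (show 0 ≤ ε ^ 2 / (8 * L ^ 2) by positivity)
    refine le_trans (le_of_eq ?_) h
    field_simp
  calc numHyp n k c * Real.exp (-(m * (ε / 2)) ^ 2 / (2 * (m * L ^ 2)))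
      ≤ Real.exp K * Real.exp (-(m * (ε ^ 2 / (8 * L ^ 2)))) := by rw [he]; gcongr
    _ = Real.exp (K + -(m * (ε ^ 2 / (8 * L ^ 2)))) := (Real.exp_add _ _).symm
    _ ≤ Real.exp (Real.log δ) := by
      rw [one_div, Real.log_inv] at hb
      exact Real.exp_le_exp.2 (by linarith)
    _ = δ := Real.exp_log hδ

/-- The exponent `c = 4(⌊1/ε⌋ + 1)` exceeds `4/ε`, and `2^c ≥ c`. -/
theorem one_div_two_pow_mixing_le {e : ℕ × ℕ} {ε : ℝ} (hε : ε = (e.1 : ℝ) / e.2)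
    (h₁ : 0 < e.1) (h₂ : 0 < e.2) :
    1 / 2 ^ mixing e ≤ ε / 4 ∧ (mixing e : ℝ) ≤ 4 * (1 / ε) + 4 := by
  have h₁' : (0 : ℝ) < e.1 := by exact_mod_cast h₁
  have h₂' : (0 : ℝ) < e.2 := by exact_mod_cast h₂
  have hε₀ : 0 < ε := by rw [hε]; positivity
  have hi : 1 / ε = (e.2 : ℝ) / e.1 := by rw [hε, one_div_div]
  have hm : (mixing e : ℝ) = 4 * ((e.2 / e.1 : ℕ) + 1) := by rw [mixing]; push_cast; ring
  constructor
  · have hlt : (mixing e : ℝ) ≤ 2 ^ mixing e := by exact_mod_cast Nat.lt_two_pow_self.le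
    have hd : 1 / ε < (e.2 / e.1 : ℕ) + 1 := by
      rw [hi, ← Nat.floor_div_eq_div (K := ℝ)]
      exact Nat.lt_floor_add_one _
    rw [div_le_div_iff₀ (by positivity) (by norm_num), one_mul]
    rw [div_lt_iff₀ hε₀] at hd
    nlinarith
  · rw [hm, hi]
    linarith [Nat.cast_div_le (α := ℝ) (m := e.2) (n := e.1)]

/-- Maximizing the likelihood over the grid learns the target. -/
theorem measure_divergence_lt_ge (G : QuantumGenerator k Bool) {n c m : ℕ} {ε δ : ℝ} (hε : 0 < ε)
    (hδ : 0 < δ) (hc : 1 ≤ c) (hcε : 1 / 2 ^ c ≤ ε / 4)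
    (hm : 8 * ((n : ℝ) + c + 1) ^ 2 * (1 / ε) ^ 2 *
      ((precision n k c + 1) * numDigits k + Real.log (1 / δ)) ≤ m)
    (sel : (Fin m → Fin n → Bool) → ℕ) (hsel : ∀ x, sel x < numHyp n k c)
    (hmax : ∀ x, ∀ h < numHyp n k c,
      ∑ i, Real.log (hypProb k c h (x i)) ≤ ∑ i, Real.log (hypProb k c (sel x) (x i))) :
    ENNReal.ofReal (1 - δ) ≤ (Measure.pi fun _ : Fin m => (G.outputDist n).toMeasure)
      {x | divergence G n c (sel x) < ε} := by
  classical
  set μ := Measure.pi fun _ : Fin m => (G.outputDist n).toMeasure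
  obtain ⟨o, ho, hdom⟩ := exists_hypProb_ge G n c
  have hdo : divergence G n c o ≤ ε / 2 := (divergence_le hc hdom).trans (by linarith)
  let g : ℕ → (Fin n → Bool) → ℝ := fun h a =>
    Real.log (hypProb k c h a) - Real.log (hypProb k c o a)
  let H := (Finset.range (numHyp n k c)).filter fun h => ε ≤ divergence G n c h
  let bad : Set (Fin m → Fin n → Bool) := ⋃ h ∈ H, {x | 0 ≤ ∑ i, g h (x i)}
  -- The selected hypothesis is at least as likely as `o`; if its divergence were at least `ε`, it
  -- would witness membership in `bad`.
  have hsub : badᶜ ⊆ {x | divergence G n c (sel x) < ε} := by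
    intro x hx
    refine Set.mem_ofPred_eq ▸ not_le.1 fun hle => hx ?_
    refine Set.mem_iUnion₂.2 ⟨sel x, Finset.mem_filter.2 ⟨Finset.mem_range.2 (hsel x), hle⟩, ?_⟩
    simp only [g, Set.mem_ofPred_eq, Finset.sum_sub_distrib]
    linarith [hmax x o ho]
  have hbad : μ.real bad ≤ δ := by
    refine (measureReal_biUnion_finset_le _ _).trans ?_
    refine le_trans ?_ (numHyp_mul_exp_le hε hδ hm)
    rw [← nsmul_eq_mul]
    refine (Finset.sum_le_card_nsmul _ _ _ fun h hh => ?_).trans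
      (nsmul_le_nsmul_left (Real.exp_pos _).le
        ((Finset.card_filter_le _ _).trans (Finset.card_range _).le))
    -- The mean of `g h` is the divergence of `o` minus that of `h`, hence at most `ε/2 - ε = -ε/2`.
    refine measureReal_pi_sum_nonneg_le _ (g h) (by positivity) (by positivity) (fun a => ?_) ?_ m
    · have h₁ := log_hypProb_mem_Icc (k := k) c h a
      have h₂ := log_hypProb_mem_Icc (k := k) c o a
      constructor <;> simp only [g] <;> linarith [h₁.1, h₁.2, h₂.1, h₂.2]
    · rw [PMF.integral_eq_sum]
      simp_rw [prob_toReal, smul_eq_mul, g]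
      rw [← divergence_sub]
      linarith [(Finset.mem_filter.1 hh).2]
  refine le_trans ?_ (measure_mono hsub)
  rw [← ofReal_measureReal, measureReal_compl (Set.toFinite bad).measurableSet, probReal_univ]
  exact ENNReal.ofReal_le_ofReal (by linarith)

end GridLearner

/-! ### The learning theorem -/

open GridLearner MvPolynomial in
theorem theorem2 :
    ∃ p : MvPolynomial (Fin 4) ℕ,
      LearnableKL quantumGeneratorClass fun n k ε δ =>
        MvPolynomial.aeval ![(n : ℝ), (k : ℝ), 1 / ε, Real.log (1 / δ)] p := by
  obtain ⟨A, hA, hout⟩ := primrecRel_isOutput.exists_computable exists_isOutput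
  -- This is the required sample size with `4/ε + 4` in place of the mixing exponent `c`. The
  -- variables stand for `n`, `k`, `1/ε` and `log (1/δ)`; all coefficients are natural numbers, so
  -- the expression is monotone in `c`.
  refine ⟨8 * (X 0 + (4 * X 2 + 4) + 1) ^ 2 * X 2 ^ 2 *
      ((4 * X 1 * (2 * X 0 + 1) + 2 * X 0 + (4 * X 2 + 4) + 2) *
        (2 * (4 * X 1) * (4 * X 1) + 4 * X 1) + X 3), fun a => (A a).2, Computable.snd.comp hA, ?_⟩
  intro n k e d he₁ he₂ hd₁ hd₂ ε δ hε hδ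
  have hcomp : ∀ (m : ℕ) (x : Fin m → Fin n → Bool),
      (A (learnerInput n k e d x)).2.Computes
        (hypDist n k (mixing e) (A (learnerInput n k e d x)).1) :=
    fun m x => (hout (learnerInput n k e d x)).2.2.computes
  refine ⟨fun m x => ⟨_, hcomp m x⟩, ?_⟩
  rintro _ ⟨G, rfl⟩ m hm
  have hd₁' : (0 : ℝ) < d.1 := by exact_mod_cast hd₁
  have hd₂' : (d.1 : ℝ) < d.2 := by exact_mod_cast hd₂
  have he₁' : (0 : ℝ) < e.1 := by exact_mod_cast he₁
  have he₂' : (0 : ℝ) < e.2 := by exact_mod_cast he₂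
  have hε₀ : 0 < ε := by rw [hε]; positivity
  have hδ₀ : 0 < δ := by rw [hδ]; exact div_pos hd₁' (hd₁'.trans hd₂')
  have hδ₁ : δ ≤ 1 := by rw [hδ]; exact (div_le_one (hd₁'.trans hd₂')).2 hd₂'.le
  have hlog : 0 ≤ Real.log (1 / δ) := Real.log_nonneg (by rwa [le_div_iff₀ hδ₀, one_mul])
  obtain ⟨hc₁, hc₂⟩ := one_div_two_pow_mixing_le hε he₁ he₂
  simp only [map_mul, map_add, map_pow, map_ofNat, map_one, aeval_X, Matrix.cons_val] at hm
  refine (measure_divergence_lt_ge (c := mixing e) G hε₀ hδ₀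
    (Nat.mul_pos four_pos (Nat.succ_pos _)) hc₁ ?_
    (fun x => (A (learnerInput n k e d x)).1) (fun x => (hout _).1)
    fun x h hh => sum_log_hypProb_le ((hout (learnerInput n k e d x)).2.1 h hh)).trans
    (measure_mono fun x hx => ⟨_, hcomp m x, ?_⟩)
  · refine le_trans ?_ hm
    generalize mixing e = c at hc₂ ⊢
    rw [precision, numDigits]
    push_cast
    have hε' : 0 < 1 / ε := by positivity
    gcongr 8 * (_ + ?_ + _) ^ 2 * _ * (?_ * _ + _)
    linarith
  · rw [klDiv_hypDist]
    exact (ENNReal.ofReal_lt_ofReal_iff hε₀).2 hx
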